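/- Let $X$ be a random variable with values in a measurable space $\mathcal X$, let $g:\mathcal X\times\mathbb R^d\to\mathbb R$ be (jointly) measurable with $g(X,h)$ integrable for every $h\in\mathbb R^d$, and assume that $G(h):=\mathbb E[g(X,h)]$ is convex on $\mathbb R^d$. Let $X_1,X_2,\dots$ be i.i.d. copies of $X$. Let $\gamma_n=c_\gamma/(n+c_\gamma')^{\gamma}$ with $c_\gamma>0$, $c_\gamma'\ge 0$, $\gamma\in(1/2,1)$, let $\tilde\theta_0$ be a random vector of $\mathbb R^d$, let $(\overline S_n)_{n\ge0}$ be random $d\times d$ matrices that are almost surely symmetric positive definite for all $n$, and let the non-averaged iterates of the weighted averaged stochastic Newton algorithm (WASNA) be $$\tilde\theta_{n+1}=\tilde\theta_n-\gamma_{n+1}\,\overline S_n^{-1}\nabla_h g(X_{n+1},\tilde\theta_n),\qquad n\ge 0 .$$ Assume that there is a filtration $(\mathcal F_n)_{n\ge 0}$ such that $\overline S_n$ and $\tilde\theta_n$ are $\mathcal F_n$-measurable and $X_{n+1}$ is independent of $\mathcal F_n$ for every $n\ge0$. Let $\|\cdot\|$ be the Euclidean norm, $\|\cdot\|_{op}$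 the corresponding operator norm and $\lambda_{\max}$ the largest eigenvalue, and let $\theta\in\mathbb R^d$. Suppose: * (A1) for almost every $x$ (with respect to the law of $X$) the function $g(x,\cdot)$ is differentiable, and (a) $\nabla G(\theta)=0$; (b) there are constants $C,C'\ge0$ such that $\mathbb E[\|\nabla_h g(X,h)\|^2]\le C+C'(G(h)-G(\theta))$ for all $h\in\mathbb R^d$; (c) $h\mapsto \mathbb E[\nabla_h g(X,h)\nabla_h g(X,h)^T]$ is continuous at $\theta$; * (A2) $G$ is twice continuously differentiable, and (a) there is $L>0$ such that $\|\nabla^2G(h)\|_{op}\le L$ for all $h\in\mathbb R^d$; (b) $H:=\nabla^2G(\theta)$ is positive definite; * (H1') there is $\beta\in(0,\gamma-1/2)$ such that, almost surely, $\lambda_{\max}(\overline S_n)=O(1)$ and $\lambda_{\max}(\overline S_n^{-1})=O(n^{\beta})$; * (H2a') $\overline S_n\to H$ almost surely as $n\to\infty$; * there are constants $\eta>0$ with $\eta>\frac1\gamma-1$ and $C_\eta>0$ such that $\mathbb E[\|\nabla_h g(X,h)\|^{2+2\eta}]\le C_\eta(1+\|h-\theta\|^{2+2\eta})$ for all $h\in\mathbb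 R^d$. Then $$\|\tilde\theta_n-\theta\|^2=O\!\left(\frac{\ln n}{n^{\gamma}}\right)\quad\text{almost surely.}$$ -/

import Mathlib

open MeasureTheory ProbabilityTheory Filter Topology Asymptotics

namespace WASNA

noncomputable section

/-- The risk `G(h) = E[g(X, h)]`, where `P` is the law of `X`. -/
def risk {d : ℕ} {𝒳 : Type*} [MeasurableSpace 𝒳] (P : Measure 𝒳)
    (g : 𝒳 → EuclideanSpace ℝ (Fin d) → ℝ) (h : EuclideanSpace ℝ (Fin d)) : ℝ :=
  ∫ x, g x h ∂P

/-- The matrix `Σ(h) = E[∇_h g(X, h) ∇_h g(X, h)ᵀ]`, where `P` is the law of `X`. -/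
def gradSecondMoment {d : ℕ} {𝒳 : Type*} [MeasurableSpace 𝒳] (P : Measure 𝒳)
    (g : 𝒳 → EuclideanSpace ℝ (Fin d) → ℝ) (h : EuclideanSpace ℝ (Fin d)) :
    Matrix (Fin d) (Fin d) ℝ :=
  Matrix.of fun i j => ∫ x, gradient (g x) h i * gradient (g x) h j ∂P

/-- The Hessian matrix of `G` at `h`, i.e. the Jacobian matrix of `∇G` at `h`. -/
def hessian {d : ℕ} (G : EuclideanSpace ℝ (Fin d) → ℝ) (h : EuclideanSpace ℝ (Fin d)) :
    Matrix (Fin d) (Fin d) ℝ :=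
  Matrix.of fun i j => fderiv ℝ (gradient G) h (EuclideanSpace.single j 1) i

/-- The operator norm of a matrix for the Euclidean norm (its largest singular value). -/
def opNorm {d : ℕ} (A : Matrix (Fin d) (Fin d) ℝ) : ℝ :=
  ‖Matrix.toEuclideanCLM (n := Fin d) (𝕜 := ℝ) A‖

/-- The largest eigenvalue of a real symmetric matrix (its spectrum is finite, and nonempty as
soon as `d ≥ 1`). -/
def lambdaMax {d : ℕ} (A : Matrix (Fin d) (Fin d) ℝ) : ℝ :=
  sSup (spectrum ℝ A)

/-- The steps `γ_n = c / (n + c') ^ γ`. -/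
def stepSize (c c' γ : ℝ) (n : ℕ) : ℝ :=
  c / ((n : ℝ) + c') ^ γ

/-- The non-averaged iterates: `θ̃_{n+1} = θ̃_n - γ_{n+1} S_n⁻¹ ∇_h g(X_{n+1}, θ̃_n)`. -/
def thetaTilde {d : ℕ} {Ω 𝒳 : Type*} (g : 𝒳 → EuclideanSpace ℝ (Fin d) → ℝ)
    (X : ℕ → Ω → 𝒳) (S : ℕ → Ω → Matrix (Fin d) (Fin d) ℝ) (step : ℕ → ℝ)
    (θ₀ : Ω → EuclideanSpace ℝ (Fin d)) : ℕ → Ω → EuclideanSpace ℝ (Fin d)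
  | 0 => θ₀
  | n + 1 => fun ω =>
      thetaTilde g X S step θ₀ n ω -
        step (n + 1) • Matrix.toEuclideanCLM (n := Fin d) (𝕜 := ℝ) (S n ω)⁻¹
          (gradient (g (X (n + 1) ω)) (thetaTilde g X S step θ₀ n ω))

end

end WASNA

/-!
The iterates are those of a stochastic gradient algorithm with preconditioners `B n = (S n)⁻¹`.
Since `S n` is positive definite and tends to the positive definite matrix `H = ∇²G(θ)`, the
operators `B n` are almost surely bounded, uniformly coercive, and tend to `H⁻¹`.

*Unbiasedness.* `E[∇g(X, h)] = ∇G(h)` (`integral_inner_gradient_eq`), although the stochastic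
gradient is not assumed continuous: by the fundamental theorem of calculus along segments the
difference quotients of `g(X, ·)` are bounded in `L²`, and they converge almost surely.
Conditional expectations given the past are computed by integrating out the new sample
(`condExp_comp_of_indep`).

*Consistency.* Localized on the event that the `B k`, `k ≤ n`, are controlled by a constant, and
suitably discounted, `G - G(θ) + 1` along the iterates is a nonnegative supermartingale which
decreases in conditional mean by at least a multiple of the step times `‖∇G‖²`
(`integrable_and_condExp_localizedExcess_le`). It therefore converges, and as the steps are not
summable, the gradients come arbitrarily close to `0`; convexity and the positive definite Hessian
at `θ` then force the iterates to converge to `θ` (`PreconditionedSGD.ae_tendsto`).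

*Rate.* Write `a n` for the steps, `Δ n` for the error and `ζ n` for the preconditioned noise. Near
`θ`, `Δ (n + 1) = (1 - a) Δ n - a ζ n + a o(‖Δ n‖)`, because `B n ∇G` is the identity to first
order. Let `m` average the noise by `m (n + 1) = (1 - a) m n + a ζ n`. Then `Δ + m` obeys a
contraction perturbed by `o(‖Δ‖)`, so that `Δ` is of the order of `m`
(`SlowStep.isBigO_rate_of_recursion`, `PreconditionedSGD.ae_norm_sub_le_rate`). That `m n` is of
the order of `√(a n log n)` is `ae_isBigO_rate_of_average`: the noise is truncated at the inverse
of this rate, which changes only finitely many terms since `η > 1 / γ - 1`, and the truncated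
average has sub-Gaussian exponential moments with variance proxy of the order of `a n`
(`integral_exp_avgFrom_le`).
-/

namespace WASNA

/-! ### Convex functions with a Lipschitz gradient -/

section Convex

variable {E : Type*} [NormedAddCommGroup E] [InnerProductSpace ℝ E] [CompleteSpace E]

theorem inner_gradient_eq_fderiv (G : E → ℝ) (x v : E) :
    inner ℝ (gradient G x) v = fderiv ℝ G x v := by
  simp [gradient]

theorem convexOn_add_inner_gradient_le {G : E → ℝ} (hG : ConvexOn ℝ Set.univ G)
    (hd : Differentiable ℝ G) (x y : E) : G x + inner ℝ (gradient G x) (y - x) ≤ G y := by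
  have hconv : ConvexOn ℝ Set.univ (G ∘ (AffineMap.lineMap x y : ℝ →ᵃ[ℝ] E)) := by
    simpa using hG.comp_affineMap (AffineMap.lineMap x y : ℝ →ᵃ[ℝ] E)
  have hder : HasDerivAt (G ∘ (AffineMap.lineMap x y : ℝ →ᵃ[ℝ] E)) (fderiv ℝ G x (y - x)) 0 := by
    have h1 : HasDerivAt (AffineMap.lineMap x y : ℝ →ᵃ[ℝ] E) (y - x) 0 :=
      AffineMap.hasDerivAt_lineMap
    have h2 : HasFDerivAt G (fderiv ℝ G x) (AffineMap.lineMap x y (0 : ℝ)) := by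
      simpa using (hd x).hasFDerivAt
    exact h2.comp_hasDerivAt 0 h1
  have h := hconv.le_slope_of_hasDerivAt (Set.mem_univ _) (Set.mem_univ 1) zero_lt_one hder
  rw [inner_gradient_eq_fderiv]
  simp only [slope_def_field, Function.comp_apply, AffineMap.lineMap_apply_one,
    AffineMap.lineMap_apply_zero, sub_zero, div_one] at h
  linarith

theorem le_add_inner_gradient_add_sq {G : E → ℝ} (hd : Differentiable ℝ G) {L : ℝ} (hL : 0 ≤ L)
    (hlip : ∀ z w, ‖gradient G z - gradient G w‖ ≤ L * ‖z - w‖) (x y : E) :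
    G y ≤ G x + inner ℝ (gradient G x) (y - x) + L * ‖y - x‖ ^ 2 := by
  have hseg : ∀ z ∈ segment ℝ x y, ‖z - x‖ ≤ ‖y - x‖ := by
    intro z hz
    rw [segment_eq_image'] at hz
    obtain ⟨t, ht, rfl⟩ := hz
    simp only [add_sub_cancel_left, norm_smul, Real.norm_eq_abs, abs_of_nonneg ht.1]
    exact mul_le_of_le_one_left (norm_nonneg _) ht.2
  have h := (convex_segment x y).norm_image_sub_le_of_norm_fderiv_le' (𝕜 := ℝ) (f := G)
    (C := L * ‖y - x‖) (φ := fderiv ℝ G x) (fun z _ => hd z) ?_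
    (left_mem_segment ℝ x y) (right_mem_segment ℝ x y)
  · rw [inner_gradient_eq_fderiv]
    have := (abs_le.1 (Real.norm_eq_abs _ ▸ h)).2
    nlinarith
  · intro z hz
    have h1 : ‖fderiv ℝ G z - fderiv ℝ G x‖ = ‖gradient G z - gradient G x‖ := by
      rw [gradient, gradient, ← map_sub, LinearIsometryEquiv.norm_map]
    rw [h1]
    exact (hlip z x).trans (mul_le_mul_of_nonneg_left (hseg z hz) hL)

/-- Strong convexity at the minimizer propagates by convexity: outside every small ball around `θ`
the excess risk grows at least linearly. -/
theorem exists_linear_growth_of_hessian {G : E → ℝ} (hG : ConvexOn ℝ Set.univ G)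
    (hd : Differentiable ℝ G) {θ : E} (h0 : gradient G θ = 0) {A : E →L[ℝ] E}
    (hA : HasFDerivAt (gradient G) A θ) {κ : ℝ} (hκ : 0 < κ)
    (hcoer : ∀ u, κ * ‖u‖ ^ 2 ≤ inner ℝ u (A u)) :
    ∃ m r : ℝ, 0 < m ∧ 0 < r ∧ ∀ ε, 0 < ε → ε ≤ r → ∀ h, ε ≤ ‖h - θ‖ →
      m * ε * ‖h - θ‖ ≤ G h - G θ := by
  have hlo := hA.isLittleO.def (half_pos hκ)
  obtain ⟨r, hr, hball⟩ := Metric.eventually_nhds_iff.1 hlo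
  refine ⟨κ / 8, r, by positivity, hr, fun ε hε hεr h hh => ?_⟩
  set D := ‖h - θ‖ with hD
  have hDpos : 0 < D := hε.trans_le hh
  -- the point of the segment `[θ, h]` at distance `ε / 2` from `θ`
  set s := ε / (2 * D) with hs
  have hspos : 0 < s := by positivity
  have hs2 : s ≤ 1 / 2 := by rw [hs, div_le_div_iff₀ (by positivity) (by norm_num)]; linarith
  set q := θ + s • (h - θ) with hq
  have hqθ : q - θ = s • (h - θ) := by simp [hq]
  have hnq : ‖q - θ‖ = ε / 2 := by
    rw [hqθ, norm_smul, Real.norm_eq_abs, abs_of_pos hspos, ← hD, hs]; field_simp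
  have hgrad : κ / 2 * ‖q - θ‖ ^ 2 ≤ inner ℝ (gradient G q) (q - θ) := by
    have h1 := hball (y := q) (by rw [dist_eq_norm, hnq]; linarith)
    rw [h0, sub_zero] at h1
    have h2 := abs_le.1 (abs_real_inner_le_norm (gradient G q - A (q - θ)) (q - θ))
    have h3 := hcoer (q - θ)
    rw [real_inner_comm] at h3
    rw [inner_sub_left] at h2
    nlinarith [norm_nonneg (q - θ), h2.1, mul_le_mul_of_nonneg_right h1 (norm_nonneg (q - θ))]
  have hθq := convexOn_add_inner_gradient_le hG hd θ q
  rw [h0, inner_zero_left, add_zero] at hθq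
  have hqh := convexOn_add_inner_gradient_le hG hd q h
  have hhq : h - q = ((1 - s) / s) • (q - θ) := by
    rw [hqθ, smul_smul, div_mul_cancel₀ _ hspos.ne', hq]; module
  rw [hhq, inner_smul_right] at hqh
  have hratio : D / ε ≤ (1 - s) / s := by
    have : D / ε = (1 / 2) / s := by rw [hs]; field_simp
    rw [this]; gcongr; linarith
  have hκε : 0 ≤ κ / 2 * (ε / 2) ^ 2 := by positivity
  rw [hnq] at hgrad
  have h5 : D / ε * (κ / 2 * (ε / 2) ^ 2) ≤ (1 - s) / s * inner ℝ (gradient G q) (q - θ) :=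
    mul_le_mul hratio hgrad hκε (le_trans (by positivity) hratio)
  have h6 : D / ε * (κ / 2 * (ε / 2) ^ 2) = κ / 8 * ε * D := by field_simp; norm_num
  linarith

end Convex

/-! ### Step sizes and the deterministic recursion -/

/-- The rate at which the iterates converge for the steps `a`: the square root of `a n * log n`. -/
noncomputable def rate (a : ℕ → ℝ) (n : ℕ) : ℝ := √(a n * Real.log n)

/-- The properties of `n ↦ c / (n + c') ^ γ`, `γ < 1`, on which the rate of convergence rests: the
steps are positive, decrease by a factor of at most `1 + a / 8` at a time, dominate `1 / n`, and
`a n * log n` tends to `0`. The value `a 0` is never used as a step. -/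
structure SlowStep (a : ℕ → ℝ) : Prop where
  pos : ∀ n, 0 < a (n + 1)
  ratio : ∀ᶠ n in atTop, a n ≤ (1 + a (n + 1) / 8) * a (n + 1)
  inv_le : ∀ᶠ n : ℕ in atTop, (n : ℝ)⁻¹ ≤ a (n + 1)
  tendsto_mul_log : Tendsto (fun n : ℕ => a n * Real.log n) atTop (𝓝 0)

theorem rate_nonneg (a : ℕ → ℝ) (n : ℕ) : 0 ≤ rate a n := Real.sqrt_nonneg _

theorem eventually_one_le_log : ∀ᶠ n : ℕ in atTop, 1 ≤ Real.log n :=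
  (Real.tendsto_log_atTop.comp tendsto_natCast_atTop_atTop).eventually_ge_atTop 1

namespace SlowStep

variable {a : ℕ → ℝ}

theorem pos_of_one_le (ha : SlowStep a) {n : ℕ} (hn : 1 ≤ n) : 0 < a n := by
  obtain ⟨k, rfl⟩ := Nat.exists_eq_add_of_le' hn
  exact ha.pos k

theorem tendsto_zero (ha : SlowStep a) : Tendsto a atTop (𝓝 0) := by
  refine squeeze_zero' (eventually_atTop.2 ⟨1, fun n hn => (ha.pos_of_one_le hn).le⟩) ?_
    ha.tendsto_mul_log
  filter_upwards [eventually_one_le_log, eventually_ge_atTop 1] with n hn h1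
  exact le_mul_of_one_le_right (ha.pos_of_one_le h1).le hn

theorem eventually_le_one (ha : SlowStep a) : ∀ᶠ n in atTop, a n ≤ 1 :=
  ha.tendsto_zero.eventually_le_const one_pos

theorem tendsto_rate (ha : SlowStep a) : Tendsto (rate a) atTop (𝓝 0) := by
  have h := (Real.continuous_sqrt.tendsto 0).comp ha.tendsto_mul_log
  rwa [Real.sqrt_zero] at h

theorem eventually_rate_pos (ha : SlowStep a) : ∀ᶠ n in atTop, 0 < rate a n := by
  filter_upwards [eventually_one_le_log, eventually_ge_atTop 1] with n hn h1
  exact Real.sqrt_pos.2 (mul_pos (ha.pos_of_one_le h1) (by linarith))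

theorem eventually_rate_le_one (ha : SlowStep a) : ∀ᶠ n in atTop, rate a n ≤ 1 :=
  ha.tendsto_rate.eventually_le_const one_pos

theorem eventually_rate_le (ha : SlowStep a) :
    ∀ᶠ n in atTop, rate a n ≤ (1 + a (n + 1) / 8) * rate a (n + 1) := by
  filter_upwards [ha.ratio, eventually_ge_atTop 1, eventually_one_le_log] with n hr h1 hlog
  have hp := ha.pos n
  have hlog' : Real.log n ≤ Real.log (n + 1 : ℕ) :=
    Real.log_le_log (by positivity) (by push_cast; linarith)
  have hx : 0 ≤ a (n + 1) * Real.log (n + 1 : ℕ) := mul_nonneg hp.le (by linarith)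
  have hle : a n * Real.log n ≤ (1 + a (n + 1) / 8) ^ 2 * (a (n + 1) * Real.log (n + 1 : ℕ)) := by
    calc a n * Real.log n ≤ (1 + a (n + 1) / 8) * a (n + 1) * Real.log (n + 1 : ℕ) := by
          gcongr
      _ = (1 + a (n + 1) / 8) * (a (n + 1) * Real.log (n + 1 : ℕ)) := by ring
      _ ≤ _ := by
          gcongr
          nlinarith
  calc rate a n ≤ √((1 + a (n + 1) / 8) ^ 2 * (a (n + 1) * Real.log (n + 1 : ℕ))) :=
        Real.sqrt_le_sqrt hle
    _ = _ := by
        rw [Real.sqrt_mul (by positivity), Real.sqrt_sq (by positivity), rate]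

theorem eventually_contract_rate_le (ha : SlowStep a) :
    ∀ᶠ n in atTop, (1 - a (n + 1) / 2) * rate a n ≤ (1 - a (n + 1) / 4) * rate a (n + 1) := by
  filter_upwards [ha.eventually_rate_le, (tendsto_add_atTop_nat 1).eventually ha.eventually_le_one]
    with n h1 h2
  have hp := ha.pos n
  calc (1 - a (n + 1) / 2) * rate a n
      ≤ (1 - a (n + 1) / 2) * ((1 + a (n + 1) / 8) * rate a (n + 1)) := by
        apply mul_le_mul_of_nonneg_left h1; linarith
    _ ≤ _ := by
        rw [← mul_assoc]
        apply mul_le_mul_of_nonneg_right _ (rate_nonneg _ _)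
        nlinarith

theorem eventually_rate_le_two_mul (ha : SlowStep a) :
    ∀ᶠ n in atTop, rate a n ≤ 2 * rate a (n + 1) := by
  filter_upwards [ha.eventually_rate_le, (tendsto_add_atTop_nat 1).eventually ha.eventually_le_one]
    with n h1 h2
  have := rate_nonneg a (n + 1)
  nlinarith

/-- A sequence contracted by `1 - a / 2` and perturbed by `a * O(rate)` at each step is
`O(rate)`. -/
theorem isBigO_rate_of_recursion (ha : SlowStep a) {x : ℕ → ℝ} {K : ℝ}
    (hx : ∀ᶠ n in atTop, x (n + 1) ≤
      (1 - a (n + 1) / 2) * x n + a (n + 1) * (K * rate a (n + 1))) :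
    ∃ B, 0 ≤ B ∧ ∀ᶠ n in atTop, x n ≤ B * rate a n := by
  obtain ⟨N, hN⟩ := eventually_atTop.1 (hx.and (ha.eventually_contract_rate_le.and
    (ha.eventually_rate_pos.and
      ((tendsto_add_atTop_nat 1).eventually ha.eventually_le_one))))
  refine ⟨max 0 (max (4 * K) (x N / rate a N)), le_max_left _ _,
    eventually_atTop.2 ⟨N, fun n hn => ?_⟩⟩
  set B := max 0 (max (4 * K) (x N / rate a N)) with hB
  have hB0 : 0 ≤ B := le_max_left _ _
  have hBK : 4 * K ≤ B := (le_max_left _ _).trans (le_max_right _ _)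
  induction n, hn using Nat.le_induction with
  | base =>
    have h1 : x N / rate a N ≤ B := (le_max_right _ _).trans (le_max_right _ _)
    exact (div_le_iff₀ (hN N le_rfl).2.2.1).1 h1
  | succ n hn ih =>
    obtain ⟨h1, h2, h3, h4⟩ := hN n hn
    have hp := ha.pos n
    have h5 : (1 - a (n + 1) / 2) * x n ≤ (1 - a (n + 1) / 2) * (B * rate a n) :=
      mul_le_mul_of_nonneg_left ih (by linarith)
    have h6 : B * ((1 - a (n + 1) / 2) * rate a n) ≤ B * ((1 - a (n + 1) / 4) * rate a (n + 1)) :=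
      mul_le_mul_of_nonneg_left h2 hB0
    have h7 : 0 ≤ a (n + 1) * rate a (n + 1) := mul_nonneg hp.le (rate_nonneg _ _)
    nlinarith

theorem not_summable (ha : SlowStep a) : ¬ Summable (fun n => a (n + 1)) := by
  intro h
  refine Real.not_summable_natCast_inv ?_
  refine Summable.of_norm_bounded_eventually_nat h ?_
  filter_upwards [ha.inv_le] with n hn
  simpa using hn

end SlowStep

section StepSize

variable {c c' γ : ℝ}

theorem stepSize_nonneg (hc : 0 < c) (hc' : 0 ≤ c') (n : ℕ) : 0 ≤ stepSize c c' γ n := by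
  unfold stepSize; positivity

theorem stepSize_le (hc : 0 < c) (hc' : 0 ≤ c') (hγ : 0 < γ) {n : ℕ} (hn : 1 ≤ n) :
    stepSize c c' γ n ≤ c / (n : ℝ) ^ γ := by
  have : (1 : ℝ) ≤ n := by exact_mod_cast hn
  unfold stepSize
  gcongr
  linarith

theorem stepSize_mul_log_eventually_le (hc : 0 < c) (hc' : 0 ≤ c') (hγ : 0 < γ) {ε : ℝ}
    (hε : 0 < ε) :
    ∀ᶠ n : ℕ in atTop, stepSize c c' γ n * Real.log n ≤ c * (n : ℝ) ^ (ε - γ) := by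
  have h1 := ((isLittleO_log_rpow_atTop hε).comp_tendsto tendsto_natCast_atTop_atTop).def one_pos
  filter_upwards [h1, eventually_ge_atTop 1] with n hn h1
  have hn1 : (1 : ℝ) ≤ n := by exact_mod_cast h1
  have hlog := Real.log_nonneg hn1
  simp only [Function.comp, Real.norm_eq_abs, one_mul, abs_of_nonneg hlog] at hn
  rw [abs_of_nonneg (by positivity)] at hn
  calc stepSize c c' γ n * Real.log n ≤ c / (n : ℝ) ^ γ * (n : ℝ) ^ ε := by
        gcongr
        exact stepSize_le hc hc' hγ h1
    _ = _ := by rw [Real.rpow_sub (by linarith)]; ring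

theorem slowStep_stepSize (hc : 0 < c) (hc' : 0 ≤ c') (hγ : 0 < γ) (hγ' : γ < 1) :
    SlowStep (stepSize c c' γ) := by
  have hx : Tendsto (fun n : ℕ => (n : ℝ) + 1 + c') atTop atTop :=
    tendsto_atTop_add_const_right _ _ (tendsto_atTop_add_const_right _ _
      tendsto_natCast_atTop_atTop)
  have hlo : ∀ᶠ n : ℕ in atTop, ((n : ℝ) + 1 + c') ^ (-(1 - γ)) ≤ c / 16 :=
    ((tendsto_rpow_neg_atTop (sub_pos.2 hγ')).comp hx).eventually_le_const (by positivity)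
  have hlo' : ∀ᶠ n : ℕ in atTop, ((n : ℝ) + 1 + c') ^ γ ≤ c / 16 * ((n : ℝ) + 1 + c') := by
    filter_upwards [hlo] with n hn
    have hpos : 0 < (n : ℝ) + 1 + c' := by positivity
    calc ((n : ℝ) + 1 + c') ^ γ = ((n : ℝ) + 1 + c') ^ (-(1 - γ)) * ((n : ℝ) + 1 + c') := by
          rw [← Real.rpow_add_one hpos.ne']; congr 1; ring
      _ ≤ _ := by gcongr
  refine ⟨fun n => ?_, ?_, ?_, ?_⟩
  · unfold stepSize; push_cast; positivity
  · filter_upwards [hlo', eventually_ge_atTop 1] with n hn h1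
    have hn1 : (1 : ℝ) ≤ n := by exact_mod_cast h1
    unfold stepSize
    push_cast
    set y := (n : ℝ) + c' with hy
    have hy1 : 1 ≤ y := by linarith
    rw [show (n : ℝ) + 1 + c' = y + 1 by rw [hy]; ring] at hn ⊢
    have hyγ : 0 < y ^ γ := by positivity
    have hyγ' : 0 < (y + 1) ^ γ := by positivity
    have h2 : (y + 1) ^ γ / y ^ γ ≤ 1 + 1 / y := by
      rw [← Real.div_rpow (by linarith) (by linarith)]
      have : (y + 1) / y = 1 + 1 / y := by field_simp
      rw [this]
      have h1 : 1 ≤ 1 + 1 / y := le_add_of_nonneg_right (by positivity)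
      simpa using Real.rpow_le_rpow_of_exponent_le h1 hγ'.le
    have h3 : 1 / y ≤ c / (y + 1) ^ γ / 8 := by
      rw [div_div, div_le_div_iff₀ (by positivity) (by positivity)]
      nlinarith
    calc c / y ^ γ = (y + 1) ^ γ / y ^ γ * (c / (y + 1) ^ γ) := by field_simp
      _ ≤ _ := by gcongr; linarith
  · have h16 : ∀ᶠ n : ℕ in atTop, (1 + c') ≤ (n : ℝ) :=
      tendsto_natCast_atTop_atTop.eventually_ge_atTop _
    filter_upwards [hlo', h16] with n hn h1
    unfold stepSize
    push_cast
    rw [inv_eq_one_div, div_le_div_iff₀ (by linarith) (by positivity)]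
    nlinarith
  · have h := stepSize_mul_log_eventually_le (c' := c') hc hc' hγ (half_pos hγ)
    refine squeeze_zero' ?_ h ?_
    · filter_upwards with n
      exact mul_nonneg (stepSize_nonneg hc hc' n) (Real.log_natCast_nonneg n)
    · have := (tendsto_rpow_neg_atTop (half_pos hγ)).comp tendsto_natCast_atTop_atTop
      have h2 : γ / 2 - γ = -(γ / 2) := by ring
      simpa [h2] using this.const_mul c

theorem summable_stepSize_sq (hc : 0 < c) (hc' : 0 ≤ c') (hγ : 1 / 2 < γ) :
    Summable (fun n => stepSize c c' γ n ^ 2) := by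
  have h1 : Summable (fun n : ℕ => c ^ 2 * (1 / (n : ℝ) ^ (2 * γ))) :=
    (Real.summable_one_div_nat_rpow.2 (by linarith)).mul_left _
  refine Summable.of_norm_bounded_eventually_nat h1 ?_
  filter_upwards [eventually_ge_atTop 1] with n hn
  rw [Real.norm_eq_abs, abs_of_nonneg (sq_nonneg _)]
  calc stepSize c c' γ n ^ 2 ≤ (c / (n : ℝ) ^ γ) ^ 2 := by
        gcongr
        · exact stepSize_nonneg hc hc' n
        · exact stepSize_le hc hc' (by linarith) hn
    _ = _ := by
        rw [mul_comm 2 γ, Real.rpow_mul (by positivity)]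
        simp [div_pow]
        ring

/-- The truncation levels `(rate n)⁻¹` are exceeded only finitely often when moments of order `q`
with `γ * q > 2` are bounded. -/
theorem summable_rate_rpow (hc : 0 < c) (hc' : 0 ≤ c') (hγ : 0 < γ) {q : ℝ} (hq : 2 / γ < q) :
    Summable (fun n => rate (stepSize c c' γ) n ^ q) := by
  have hq0 : 0 < q := lt_trans (by positivity) hq
  have hγq : 2 < q * γ := (div_lt_iff₀ hγ).1 hq
  -- `ε` is chosen so that `(γ - ε) * q / 2 > 1`
  set ε := (γ - 2 / q) / 2 with hεdef
  have hε : 0 < ε := by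
    have : 2 / q < γ := by rw [div_lt_iff₀ hq0]; linarith
    rw [hεdef]; linarith
  have hexp : 1 < (γ - ε) * (q / 2) := by
    have : (γ - ε) * (q / 2) = (γ * q + 2) / 4 := by rw [hεdef]; field_simp; ring
    rw [this]; linarith
  have h1 : Summable (fun n : ℕ => c ^ (q / 2) * (1 / (n : ℝ) ^ ((γ - ε) * (q / 2)))) :=
    (Real.summable_one_div_nat_rpow.2 hexp).mul_left _
  refine Summable.of_norm_bounded_eventually_nat h1 ?_
  filter_upwards [stepSize_mul_log_eventually_le (c' := c') hc hc' hγ hε, eventually_ge_atTop 1]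
    with n hn hn1
  have hnn : 0 ≤ stepSize c c' γ n * Real.log n :=
    mul_nonneg (stepSize_nonneg hc hc' n) (Real.log_natCast_nonneg n)
  rw [Real.norm_eq_abs, abs_of_nonneg (Real.rpow_nonneg (rate_nonneg _ _) _), rate,
    Real.sqrt_eq_rpow, ← Real.rpow_mul hnn]
  calc (stepSize c c' γ n * Real.log n) ^ (1 / 2 * q)
      ≤ (c * (n : ℝ) ^ (ε - γ)) ^ (1 / 2 * q) := by gcongr
    _ = _ := by
        rw [Real.mul_rpow hc.le (by positivity), ← Real.rpow_mul (by positivity),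
          one_div ((n : ℝ) ^ _), ← Real.rpow_neg (by positivity)]
        congr 2 <;> ring

end StepSize

/-! ### Almost sure rate of a recursively averaged martingale difference sequence -/

namespace SlowStep

variable {a : ℕ → ℝ}

/-- The exponential moments of the truncated average at time `n` are controlled at parameters up to
`log n / rate a n / 2`; a step of the recursion maps this range into that of the previous time. -/
theorem eventually_contract_log_div_rate_le (ha : SlowStep a) :
    ∀ᶠ n : ℕ in atTop, (1 - a (n + 1)) * (Real.log (n + 1 : ℕ) / rate a (n + 1)) ≤
      Real.log n / rate a n := by
  have hlog2 : ∀ᶠ n : ℕ in atTop, 2 ≤ Real.log n :=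
    (Real.tendsto_log_atTop.comp tendsto_natCast_atTop_atTop).eventually_ge_atTop 2
  filter_upwards [ha.eventually_rate_le, ha.inv_le, hlog2, ha.eventually_rate_pos,
    (tendsto_add_atTop_nat 1).eventually ha.eventually_rate_pos, eventually_ge_atTop 1,
    (tendsto_add_atTop_nat 1).eventually ha.eventually_le_one] with n h1 h2 h3 h4 h5 h6 h7
  have hp := ha.pos n
  have hn : (1 : ℝ) ≤ n := by exact_mod_cast h6
  have hinc : Real.log (n + 1 : ℕ) - Real.log n ≤ a (n + 1) := by
    rw [← Real.log_div (by positivity) (by positivity)]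
    refine (Real.log_le_sub_one_of_pos (by positivity)).trans (le_trans (le_of_eq ?_) h2)
    push_cast
    field_simp
    ring
  have hL : 0 ≤ Real.log (n + 1 : ℕ) := Real.log_natCast_nonneg _
  have hlog' : Real.log n ≤ Real.log (n + 1 : ℕ) :=
    Real.log_le_log (by positivity) (by push_cast; linarith)
  rw [mul_div_assoc', div_le_div_iff₀ h5 h4]
  calc (1 - a (n + 1)) * Real.log (n + 1 : ℕ) * rate a n
      ≤ (1 - a (n + 1)) * Real.log (n + 1 : ℕ) * ((1 + a (n + 1) / 8) * rate a (n + 1)) := by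
        apply mul_le_mul_of_nonneg_left h1
        exact mul_nonneg (by linarith) hL
    _ = (1 - a (n + 1)) * (1 + a (n + 1) / 8) * Real.log (n + 1 : ℕ) * rate a (n + 1) := by ring
    _ ≤ _ := by
        apply mul_le_mul_of_nonneg_right _ h5.le
        calc (1 - a (n + 1)) * (1 + a (n + 1) / 8) * Real.log (n + 1 : ℕ)
            ≤ (1 - a (n + 1) / 2) * Real.log (n + 1 : ℕ) := by
              apply mul_le_mul_of_nonneg_right _ hL
              nlinarith
          _ ≤ _ := by nlinarith

theorem eventually_variance_step_le (ha : SlowStep a) :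
    ∀ᶠ n in atTop, a (n + 1) ^ 2 + a n * (1 - a (n + 1)) ^ 2 ≤ a (n + 1) := by
  filter_upwards [ha.ratio, (tendsto_add_atTop_nat 1).eventually ha.eventually_le_one] with n h1 h2
  have hp := ha.pos n
  have h3 : a n * (1 - a (n + 1)) ^ 2 ≤
      (1 + a (n + 1) / 8) * a (n + 1) * (1 - a (n + 1)) ^ 2 :=
    mul_le_mul_of_nonneg_right h1 (sq_nonneg _)
  have h4 : (1 + a (n + 1) / 8) * (1 - a (n + 1)) ≤ 1 := by nlinarith
  have h5 : 0 ≤ a (n + 1) * (1 - a (n + 1)) := mul_nonneg hp.le (by linarith)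
  nlinarith

end SlowStep

section Martingale

variable {Ω : Type*} {mΩ : MeasurableSpace Ω} {μ : Measure Ω} [IsProbabilityMeasure μ]

theorem ae_eventually_notMem_of_real_le {s : ℕ → Set Ω} {f : ℕ → ℝ} (hf : Summable f)
    (h : ∀ᶠ n in atTop, μ.real (s n) ≤ f n) : ∀ᵐ ω ∂μ, ∀ᶠ n in atTop, ω ∉ s n := by
  have hs : Summable (fun n => μ.real (s n)) := by
    refine Summable.of_norm_bounded_eventually_nat hf ?_
    filter_upwards [h] with n hn
    rwa [Real.norm_eq_abs, abs_of_nonneg measureReal_nonneg]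
  refine ae_eventually_notMem ?_
  have := hs.tsum_ofReal_ne_top
  simpa [Measure.real] using this

theorem integral_mul_le_of_condExp_le {m : MeasurableSpace Ω} (hm : m ≤ mΩ) {F W : Ω → ℝ}
    {C b : ℝ} (hF : StronglyMeasurable[m] F) (hF0 : ∀ ω, 0 ≤ F ω) (hFb : ∀ᵐ ω ∂μ, ‖F ω‖ ≤ b)
    (hW : Integrable W μ) (hWC : ∀ᵐ ω ∂μ, (μ[W|m]) ω ≤ C) :
    ∫ ω, F ω * W ω ∂μ ≤ C * ∫ ω, F ω ∂μ := by
  have h1 := condExp_stronglyMeasurable_mul_of_bound hm hF hW b hFb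
  have hFint : Integrable F μ := ⟨(hF.mono hm).aestronglyMeasurable, .of_bounded hFb⟩
  calc ∫ ω, F ω * W ω ∂μ = ∫ ω, (μ[F * W|m]) ω ∂μ := (integral_condExp hm).symm
    _ = ∫ ω, F ω * (μ[W|m]) ω ∂μ := integral_congr_ae h1
    _ ≤ ∫ ω, C * F ω ∂μ := by
        refine integral_mono_ae ?_ (hFint.const_mul C) ?_
        · exact integrable_condExp.congr h1
        · filter_upwards [hWC] with ω hω
          nlinarith [hF0 ω]
    _ = _ := integral_const_mul _ _

/-- Truncation of a real function at level `τ`: values larger than `τ` in absolute value are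
replaced by `0`. -/
noncomputable def trunc (τ : ℝ) (z : Ω → ℝ) (ω : Ω) : ℝ := if |z ω| ≤ τ then z ω else 0

theorem abs_trunc_le {τ : ℝ} (hτ : 0 ≤ τ) (z : Ω → ℝ) (ω : Ω) : |trunc τ z ω| ≤ τ := by
  unfold trunc
  split_ifs with h <;> simp [h, hτ]

theorem measurable_trunc {m : MeasurableSpace Ω} (τ : ℝ) {z : Ω → ℝ} (hz : Measurable[m] z) :
    Measurable[m] (trunc τ z) :=
  Measurable.ite (measurableSet_le (by fun_prop) measurable_const) hz measurable_const

theorem integrable_trunc {τ : ℝ} (hτ : 0 ≤ τ) {z : Ω → ℝ} (hz : Measurable z) :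
    Integrable (trunc τ z) μ :=
  ⟨(measurable_trunc τ hz).aestronglyMeasurable,
    .of_bounded (C := τ) (ae_of_all _ fun ω => abs_trunc_le hτ z ω)⟩

theorem sq_le_one_add_rpow {x q : ℝ} (hx : 0 ≤ x) (hq : 2 ≤ q) : x ^ 2 ≤ 1 + x ^ q := by
  have h0 := Real.rpow_nonneg hx q
  rcases le_total x 1 with h | h
  · nlinarith
  · have := Real.rpow_le_rpow_of_exponent_le h hq
    rw [Real.rpow_two] at this
    linarith

/-- Centring a truncated martingale difference costs a bias of the order of the inverse of the
truncation level. -/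
theorem ae_abs_condExp_trunc_le {m : MeasurableSpace Ω} {z : Ω → ℝ} {q K v : ℝ}
    (hq : 2 ≤ q) (hz : Measurable[mΩ] z) (hzint : Integrable z μ)
    (hzq : Integrable (fun ω => |z ω| ^ q) μ) (h0 : μ[z|m] =ᵐ[μ] 0)
    (hK : ∀ᵐ ω ∂μ, (μ[fun ω => |z ω| ^ q|m]) ω ≤ K) (hv : 0 < v) (hv1 : v ≤ 1) :
    ∀ᵐ ω ∂μ, |(μ[trunc v⁻¹ z|m]) ω| ≤ K * v := by
  have hT : Integrable (trunc v⁻¹ z) μ := integrable_trunc (by positivity) hz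
  have hpt : ∀ ω, |trunc v⁻¹ z ω - z ω| ≤ v * |z ω| ^ q := by
    intro ω
    unfold trunc
    split_ifs with h
    · simp only [sub_self, abs_zero]; positivity
    · push Not at h
      rw [zero_sub, abs_neg]
      have h1 : 1 ≤ v * |z ω| := by
        rw [← mul_inv_cancel₀ hv.ne']
        exact mul_le_mul_of_nonneg_left h.le hv.le
      have h2 : 1 ≤ |z ω| := by nlinarith [abs_nonneg (z ω)]
      have h3 := Real.rpow_le_rpow_of_exponent_le h2 hq
      rw [Real.rpow_two] at h3
      nlinarith
  have hup : μ[trunc v⁻¹ z - z|m] ≤ᵐ[μ] μ[v • fun ω => |z ω| ^ q|m] :=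
    condExp_mono (hT.sub hzint) (hzq.smul v)
      (ae_of_all _ fun ω => (abs_le.1 (hpt ω)).2)
  have hlo : μ[(-v) • fun ω => |z ω| ^ q|m] ≤ᵐ[μ] μ[trunc v⁻¹ z - z|m] :=
    condExp_mono (hzq.smul (-v)) (hT.sub hzint)
      (ae_of_all _ fun ω => by simpa using (abs_le.1 (hpt ω)).1)
  filter_upwards [hup, hlo, condExp_sub hT hzint m, condExp_smul (μ := μ) v (fun ω => |z ω| ^ q) m,
    condExp_smul (μ := μ) (-v) (fun ω => |z ω| ^ q) m, h0, hK] with ω h1 h2 h3 h4 h5 h6 h7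
  rw [h3, h4] at h1
  rw [h3, h5] at h2
  simp only [Pi.sub_apply, Pi.smul_apply, smul_eq_mul, h6, Pi.zero_apply, sub_zero] at h1 h2
  have := mul_le_mul_of_nonneg_left h7 hv.le
  rw [abs_le]
  constructor <;> nlinarith

/-- Conditional exponential moments of a truncated and centred martingale difference. -/
theorem ae_condExp_exp_trunc_le {m : MeasurableSpace Ω} (hm : m ≤ mΩ) {z : Ω → ℝ} {q K v t : ℝ}
    (hq : 2 ≤ q) (hz : Measurable[mΩ] z) (hzint : Integrable z μ)
    (hzq : Integrable (fun ω => |z ω| ^ q) μ) (h0 : μ[z|m] =ᵐ[μ] 0)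
    (hK : ∀ᵐ ω ∂μ, (μ[fun ω => |z ω| ^ q|m]) ω ≤ K) (hK0 : 0 ≤ K) (hv : 0 < v) (hv1 : v ≤ 1)
    (ht : |t| * (2 * v⁻¹) ≤ 1) :
    ∀ᵐ ω ∂μ, (μ[fun ω => Real.exp (t * (trunc v⁻¹ z ω - (μ[trunc v⁻¹ z|m]) ω))|m]) ω ≤
      Real.exp ((2 + 2 * K + 2 * K ^ 2) * t ^ 2) := by
  have hτ : 0 ≤ v⁻¹ := by positivity
  have hT : Integrable (trunc v⁻¹ z) μ := integrable_trunc hτ hz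
  have hbias := ae_abs_condExp_trunc_le hq hz hzint hzq h0 hK hv hv1
  have hbτ : ∀ᵐ ω ∂μ, |(μ[trunc v⁻¹ z|m]) ω| ≤ v⁻¹ :=
    ae_bdd_abs_condExp_of_ae_bdd_abs (ae_of_all _ fun ω => abs_trunc_le hτ z ω)
  set b := μ[trunc v⁻¹ z|m] with hb
  set w : Ω → ℝ := trunc v⁻¹ z - b with hw
  have hwint : Integrable w μ := hT.sub integrable_condExp
  have hw0 : μ[w|m] =ᵐ[μ] 0 := by
    filter_upwards [condExp_sub hT (integrable_condExp (m := m) (f := trunc v⁻¹ z)) m] with ω h1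
    rw [hw, h1, condExp_of_stronglyMeasurable hm stronglyMeasurable_condExp integrable_condExp]
    simp
  have htw : ∀ᵐ ω ∂μ, |t * w ω| ≤ 1 := by
    filter_upwards [hbτ] with ω hω
    have h1 : |w ω| ≤ 2 * v⁻¹ :=
      (abs_sub _ _).trans (by linarith [abs_trunc_le hτ z ω])
    rw [abs_mul]
    exact (mul_le_mul_of_nonneg_left h1 (abs_nonneg t)).trans ht
  have hexpint : Integrable (fun ω => Real.exp (t * w ω)) μ := by
    refine ⟨Real.continuous_exp.comp_aestronglyMeasurable
      (hwint.aestronglyMeasurable.const_mul t), .of_bounded (C := Real.exp 1) ?_⟩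
    filter_upwards [htw] with ω hω
    rw [Real.norm_eq_abs, Real.abs_exp]
    exact Real.exp_le_exp.2 ((le_abs_self _).trans hω)
  -- the quadratic majorant of the exponential
  let R : Ω → ℝ := (fun _ => 1 + t ^ 2 * (2 + 2 * K ^ 2)) + t • w +
    (2 * t ^ 2) • fun ω => |z ω| ^ q
  have hRint : Integrable R μ := ((integrable_const _).add (hwint.smul t)).add (hzq.smul _)
  have hle : (fun ω => Real.exp (t * w ω)) ≤ᵐ[μ] R := by
    filter_upwards [htw, hbias] with ω h1 h2
    have h3 := (abs_le.1 (Real.abs_exp_sub_one_sub_id_le h1)).2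
    have h4 : trunc v⁻¹ z ω ^ 2 ≤ 1 + |z ω| ^ q := by
      have h := sq_le_one_add_rpow (abs_nonneg (z ω)) hq
      unfold trunc
      split_ifs
      · rwa [sq_abs] at h
      · have := Real.rpow_nonneg (abs_nonneg (z ω)) q
        simp only [ne_eq, OfNat.ofNat_ne_zero, not_false_eq_true, zero_pow]; linarith
    have h5 : b ω ^ 2 ≤ K ^ 2 := by
      rw [← sq_abs]
      exact pow_le_pow_left₀ (abs_nonneg _) (h2.trans (mul_le_of_le_one_right hK0 hv1)) 2
    have h6 : w ω ^ 2 ≤ 2 * (1 + |z ω| ^ q) + 2 * K ^ 2 := by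
      simp only [hw, Pi.sub_apply]
      nlinarith [sq_nonneg (trunc v⁻¹ z ω + b ω)]
    have h7 := mul_le_mul_of_nonneg_left h6 (sq_nonneg t)
    simp only [R, Pi.add_apply, Pi.smul_apply, smul_eq_mul]
    nlinarith
  have hmono := condExp_mono (m := m) hexpint hRint hle
  have hR1 := condExp_add (m := m) ((integrable_const (μ := μ) (1 + t ^ 2 * (2 + 2 * K ^ 2))).add
    (hwint.smul t)) (hzq.smul (2 * t ^ 2))
  have hR2 := condExp_add (m := m) (integrable_const (μ := μ) (1 + t ^ 2 * (2 + 2 * K ^ 2)))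
    (hwint.smul t)
  filter_upwards [hmono, hR1, hR2, condExp_smul (μ := μ) t w m,
    condExp_smul (μ := μ) (2 * t ^ 2) (fun ω => |z ω| ^ q) m, hw0, hK]
    with ω h1 h2 h3 h4 h5 h6 h7
  refine h1.trans ?_
  rw [show R = (fun _ => 1 + t ^ 2 * (2 + 2 * K ^ 2)) + t • w +
    (2 * t ^ 2) • fun ω => |z ω| ^ q from rfl, h2, Pi.add_apply, h3, Pi.add_apply, h4, h5,
    condExp_const hm]
  simp only [Pi.smul_apply, smul_eq_mul, h6, Pi.zero_apply, mul_zero, add_zero]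
  have h8 := Real.add_one_le_exp ((2 + 2 * K + 2 * K ^ 2) * t ^ 2)
  nlinarith [mul_le_mul_of_nonneg_left h7 (sq_nonneg t)]

end Martingale

section RecursiveAverage

variable {Ω : Type*} {mΩ : MeasurableSpace Ω} {μ : Measure Ω}

/-- The recursive average of the noise `w` with steps `a`, started from `0` at time `N`; the noise
`w n` enters at time `n + 1`. -/
noncomputable def avgFrom (a : ℕ → ℝ) (N : ℕ) (w : ℕ → Ω → ℝ) : ℕ → Ω → ℝ
  | 0 => 0
  | n + 1 => if n < N then 0 else (1 - a (n + 1)) • avgFrom a N w n + a (n + 1) • w n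

theorem avgFrom_self (a : ℕ → ℝ) (N : ℕ) (w : ℕ → Ω → ℝ) : avgFrom a N w N = 0 := by
  cases N <;> simp [avgFrom]

theorem avgFrom_succ (a : ℕ → ℝ) {N n : ℕ} (hn : N ≤ n) (w : ℕ → Ω → ℝ) (ω : Ω) :
    avgFrom a N w (n + 1) ω = (1 - a (n + 1)) * avgFrom a N w n ω + a (n + 1) * w n ω := by
  simp [avgFrom, not_lt.2 hn]

theorem stronglyMeasurable_avgFrom {ℱ : Filtration ℕ mΩ} (a : ℕ → ℝ) (N : ℕ) {w : ℕ → Ω → ℝ}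
    (hw : ∀ n, StronglyMeasurable[ℱ (n + 1)] (w n)) (n : ℕ) :
    StronglyMeasurable[ℱ n] (avgFrom a N w n) := by
  induction n with
  | zero => exact stronglyMeasurable_zero
  | succ n ih =>
    unfold avgFrom
    split_ifs
    · exact stronglyMeasurable_zero
    · exact ((ih.mono (ℱ.mono n.le_succ)).const_smul _).add ((hw n).const_smul _)

theorem ae_bounded_avgFrom (a : ℕ → ℝ) (N : ℕ) {w : ℕ → Ω → ℝ}
    (hw : ∀ n, ∃ b, ∀ᵐ ω ∂μ, |w n ω| ≤ b) (n : ℕ) :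
    ∃ b, ∀ᵐ ω ∂μ, |avgFrom a N w n ω| ≤ b := by
  induction n with
  | zero => exact ⟨0, ae_of_all _ fun ω => by simp [avgFrom]⟩
  | succ n ih =>
    by_cases h : n < N
    · exact ⟨0, ae_of_all _ fun ω => by simp [avgFrom, h]⟩
    · obtain ⟨b, hb⟩ := ih
      obtain ⟨b', hb'⟩ := hw n
      refine ⟨|1 - a (n + 1)| * b + |a (n + 1)| * b', ?_⟩
      filter_upwards [hb, hb'] with ω h1 h2
      rw [avgFrom_succ a (not_lt.1 h)]
      refine (abs_add_le _ _).trans ?_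
      rw [abs_mul, abs_mul]
      gcongr

variable [IsProbabilityMeasure μ]

theorem integrable_exp_mul_of_bounded {f : Ω → ℝ} (hf : StronglyMeasurable f)
    (hb : ∃ b, ∀ᵐ ω ∂μ, |f ω| ≤ b) (t : ℝ) : Integrable (fun ω => Real.exp (t * f ω)) μ := by
  obtain ⟨b, hb⟩ := hb
  refine ⟨Real.continuous_exp.comp_aestronglyMeasurable (hf.aestronglyMeasurable.const_mul t),
    .of_bounded (C := Real.exp (|t| * b)) ?_⟩
  filter_upwards [hb] with ω hω
  rw [Real.norm_eq_abs, Real.abs_exp]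
  refine Real.exp_le_exp.2 ((le_abs_self _).trans ?_)
  rw [abs_mul]
  gcongr

/-- The average of sub-Gaussian noise is sub-Gaussian with variance proxy of the order of the
current step: the contraction `(1 - a) ^ 2` leaves room for the fresh variance `a ^ 2`. -/
theorem integral_exp_avgFrom_le {ℱ : Filtration ℕ mΩ} {a : ℕ → ℝ} (ha : SlowStep a) {N : ℕ}
    {w : ℕ → Ω → ℝ} {σ : ℝ} (hσ : 0 ≤ σ)
    (hN : ∀ n, N ≤ n → a (n + 1) ≤ 1 ∧ 0 < rate a (n + 1) ∧ 0 < Real.log (n + 1 : ℕ) ∧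
      (1 - a (n + 1)) * (Real.log (n + 1 : ℕ) / rate a (n + 1)) ≤ Real.log n / rate a n ∧
      a (n + 1) ^ 2 + a n * (1 - a (n + 1)) ^ 2 ≤ a (n + 1))
    (ha0 : ∀ n, N ≤ n → 0 ≤ a n)
    (hw : ∀ n, StronglyMeasurable[ℱ (n + 1)] (w n))
    (hwb : ∀ n, ∃ b, ∀ᵐ ω ∂μ, |w n ω| ≤ b)
    (hexp : ∀ n, N ≤ n → ∀ t, |t| * (2 * (rate a (n + 1))⁻¹) ≤ 1 →
      ∀ᵐ ω ∂μ, (μ[fun ω => Real.exp (t * w n ω)|ℱ n]) ω ≤ Real.exp (σ * t ^ 2))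
    {n : ℕ} (hn : N ≤ n) :
    ∀ l : ℝ, |l| ≤ Real.log n / rate a n / 2 →
      ∫ ω, Real.exp (l * avgFrom a N w n ω) ∂μ ≤ Real.exp (σ * a n * l ^ 2) := by
  induction n, hn using Nat.le_induction with
  | base =>
    intro l _
    rw [avgFrom_self]
    simp only [Pi.zero_apply, mul_zero, Real.exp_zero, integral_const, probReal_univ, smul_eq_mul,
      mul_one]
    exact Real.one_le_exp (mul_nonneg (mul_nonneg hσ (ha0 N le_rfl)) (sq_nonneg l))
  | succ n hn ih =>
    intro l hl
    obtain ⟨h1, h2, h3, h4, h5⟩ := hN n hn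
    have hp := ha.pos n
    have hl1 : |(1 - a (n + 1)) * l| ≤ Real.log n / rate a n / 2 := by
      rw [abs_mul, abs_of_nonneg (by linarith)]
      calc (1 - a (n + 1)) * |l|
          ≤ (1 - a (n + 1)) * (Real.log (n + 1 : ℕ) / rate a (n + 1) / 2) :=
            mul_le_mul_of_nonneg_left hl (by linarith)
        _ ≤ _ := by linarith
    have hrate : rate a (n + 1) ^ 2 = a (n + 1) * Real.log (n + 1 : ℕ) :=
      Real.sq_sqrt (mul_nonneg hp.le h3.le)
    have hl2 : |l * a (n + 1)| * (2 * (rate a (n + 1))⁻¹) ≤ 1 := by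
      rw [abs_mul, abs_of_pos hp]
      calc |l| * a (n + 1) * (2 * (rate a (n + 1))⁻¹)
          ≤ Real.log (n + 1 : ℕ) / rate a (n + 1) / 2 * a (n + 1) * (2 * (rate a (n + 1))⁻¹) := by
            gcongr
        _ = a (n + 1) * Real.log (n + 1 : ℕ) / rate a (n + 1) ^ 2 := by field_simp
        _ = 1 := by rw [hrate, div_self (mul_pos hp h3).ne']
    set A := avgFrom a N w n with hA
    have hAm := stronglyMeasurable_avgFrom a N hw n
    have hAb := ae_bounded_avgFrom (μ := μ) a N hwb n
    obtain ⟨b, hb⟩ := hAb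
    have hstep := integral_mul_le_of_condExp_le (μ := μ) (ℱ.le n)
      (F := fun ω => Real.exp ((1 - a (n + 1)) * l * A ω))
      (b := Real.exp (|(1 - a (n + 1)) * l| * b))
      (Real.continuous_exp.comp_stronglyMeasurable (hAm.const_mul _))
      (fun ω => (Real.exp_pos _).le) ?_
      (integrable_exp_mul_of_bounded ((hw n).mono (ℱ.le _)) (hwb n) (l * a (n + 1)))
      (hexp n hn _ hl2)
    · calc ∫ ω, Real.exp (l * avgFrom a N w (n + 1) ω) ∂μ
          = ∫ ω, Real.exp ((1 - a (n + 1)) * l * A ω) * Real.exp (l * a (n + 1) * w n ω) ∂μ := by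
            refine integral_congr_ae (ae_of_all _ fun ω => ?_)
            simp only
            rw [avgFrom_succ a hn, ← Real.exp_add]
            congr 1
            ring
        _ ≤ Real.exp (σ * (l * a (n + 1)) ^ 2) *
              Real.exp (σ * a n * ((1 - a (n + 1)) * l) ^ 2) :=
            hstep.trans (mul_le_mul_of_nonneg_left (ih _ hl1) (Real.exp_pos _).le)
        _ ≤ _ := by
            rw [← Real.exp_add]
            refine Real.exp_le_exp.2 ?_
            have := mul_le_mul_of_nonneg_left h5 (mul_nonneg hσ (sq_nonneg l))
            nlinarith
    · filter_upwards [hb] with ω hω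
      rw [Real.norm_eq_abs, Real.abs_exp]
      refine Real.exp_le_exp.2 ((le_abs_self _).trans ?_)
      rw [abs_mul]
      gcongr

/-- The almost sure rate of a recursive average of martingale differences with conditional moments
of order `q`. The noise is truncated at level `(rate a)⁻¹`: only finitely many terms are changed
(Borel-Cantelli and the moment of order `q`), the bias of the truncated noise is `O(rate a)`, and
the exponential moments of the truncated average, taken at `log n / (2 * rate a n)`, give summable
tails at the level `rate a n`. -/
theorem ae_isBigO_rate_of_average {ℱ : Filtration ℕ mΩ} {a : ℕ → ℝ} (ha : SlowStep a) {q K : ℝ}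
    (hq : 2 ≤ q) (hsum : Summable fun n => rate a n ^ q) {ζ M : ℕ → Ω → ℝ}
    (hζ : ∀ n, Measurable[ℱ (n + 1)] (ζ n)) (hint : ∀ n, Integrable (ζ n) μ)
    (hintq : ∀ n, Integrable (fun ω => |ζ n ω| ^ q) μ)
    (h0 : ∀ n, μ[ζ n|ℱ n] =ᵐ[μ] 0) (hK0 : 0 ≤ K)
    (hK : ∀ n, ∀ᵐ ω ∂μ, (μ[fun ω => |ζ n ω| ^ q|ℱ n]) ω ≤ K)
    (hM : ∀ n ω, M (n + 1) ω = (1 - a (n + 1)) * M n ω + a (n + 1) * ζ n ω) :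
    ∀ᵐ ω ∂μ, ∃ B, 0 ≤ B ∧ ∀ᶠ n in atTop, |M n ω| ≤ B * rate a n := by
  have hζ' : ∀ n, Measurable[mΩ] (ζ n) := fun n => (hζ n).mono (ℱ.le _) le_rfl
  have hs : Tendsto (fun n => n + 1) atTop atTop := tendsto_add_atTop_nat 1
  obtain ⟨N, hN⟩ := eventually_atTop.1 ((hs.eventually ha.eventually_le_one).and
    ((hs.eventually ha.eventually_rate_pos).and ((hs.eventually ha.eventually_rate_le_one).and
    ((hs.eventually eventually_one_le_log).and (ha.eventually_contract_log_div_rate_le.and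
    (ha.eventually_variance_step_le.and (eventually_ge_atTop 1)))))))
  set T : ℕ → Ω → ℝ := fun n => trunc (rate a (n + 1))⁻¹ (ζ n) with hT
  set w : ℕ → Ω → ℝ := fun n ω => T n ω - (μ[T n|ℱ n]) ω with hw
  set A := avgFrom a N w with hA
  set σ := 2 + 2 * K + 2 * K ^ 2 with hσ
  have hσ0 : 0 ≤ σ := by positivity
  have hτ : ∀ n, 0 ≤ (rate a (n + 1))⁻¹ := fun n => inv_nonneg.2 (rate_nonneg _ _)
  have hwm : ∀ n, StronglyMeasurable[ℱ (n + 1)] (w n) := fun n =>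
    (measurable_trunc _ (hζ n)).stronglyMeasurable.sub
      (stronglyMeasurable_condExp.mono (ℱ.mono n.le_succ))
  have hwb : ∀ n, ∃ b, ∀ᵐ ω ∂μ, |w n ω| ≤ b := by
    intro n
    refine ⟨(rate a (n + 1))⁻¹ + (rate a (n + 1))⁻¹, ?_⟩
    have hb : ∀ᵐ ω ∂μ, |(μ[T n|ℱ n]) ω| ≤ (rate a (n + 1))⁻¹ :=
      ae_bdd_abs_condExp_of_ae_bdd_abs (ae_of_all _ fun ω => abs_trunc_le (hτ n) _ ω)
    filter_upwards [hb] with ω h1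
    exact (abs_sub _ _).trans (add_le_add (abs_trunc_le (hτ n) _ ω) h1)
  have hmom : ∀ n, N ≤ n → ∀ l : ℝ, |l| ≤ Real.log n / rate a n / 2 →
      ∫ ω, Real.exp (l * A n ω) ∂μ ≤ Real.exp (σ * a n * l ^ 2) := fun n hn =>
    integral_exp_avgFrom_le (ℱ := ℱ) ha hσ0
      (fun n hn => by
        obtain ⟨h1, h2, -, h4, h5, h6, -⟩ := hN n hn
        exact ⟨h1, h2, by linarith, h5, h6⟩)
      (fun n hn => (ha.pos_of_one_le (hN n hn).2.2.2.2.2.2).le) hwm hwb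
      (fun n hn t ht => ae_condExp_exp_trunc_le (ℱ.le n) hq (hζ' n) (hint n) (hintq n) (h0 n)
        (hK n) hK0 (hN n hn).2.1 (hN n hn).2.2.1 ht) hn
  -- tails of the truncated average
  have htail : ∀ᵐ ω ∂μ, ∀ᶠ n in atTop,
      ω ∉ {ω | (4 + σ / 2) * rate a n ≤ A n ω} ∪ {ω | A n ω ≤ -((4 + σ / 2) * rate a n)} := by
    have hsq : Summable (fun n : ℕ => 2 * (1 / (n : ℝ) ^ 2)) :=
      (Real.summable_one_div_nat_pow.2 one_lt_two).mul_left 2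
    refine ae_eventually_notMem_of_real_le hsq ?_
    filter_upwards [eventually_ge_atTop N, ha.eventually_rate_pos, eventually_one_le_log,
      eventually_ge_atTop 1] with n hn hr hlog h1
    have hn0 : (0 : ℝ) < n := by exact_mod_cast h1
    have hrate : rate a n ^ 2 = a n * Real.log n :=
      Real.sq_sqrt (mul_nonneg (ha.pos_of_one_le h1).le (by linarith))
    set l := Real.log n / rate a n / 2 with hl
    have hl0 : 0 ≤ l := by positivity
    have hlr : l * rate a n = Real.log n / 2 := by rw [hl]; field_simp
    have hal : a n * l ^ 2 = Real.log n / 4 := by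
      have : a n * l ^ 2 = (a n * Real.log n) * Real.log n / (4 * rate a n ^ 2) := by
        rw [hl]; field_simp; norm_num
      rw [this, ← hrate]; field_simp
    have hexpint := fun t => integrable_exp_mul_of_bounded (μ := μ)
      ((stronglyMeasurable_avgFrom a N hwm n).mono (ℱ.le n)) (ae_bounded_avgFrom a N hwb n) t
    have hval : ∀ t : ℝ, |t| = l → mgf (A n) μ t ≤ Real.exp (σ * (Real.log n / 4)) := by
      intro t ht
      refine (hmom n hn t ht.le).trans (le_of_eq ?_)
      rw [mul_assoc, ← sq_abs, ht, hal]
    have hsmall : Real.exp (-((4 + σ / 2) * (Real.log n / 2))) *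
        Real.exp (σ * (Real.log n / 4)) = 1 / (n : ℝ) ^ 2 := by
      rw [← Real.exp_add, show -((4 + σ / 2) * (Real.log n / 2)) + σ * (Real.log n / 4) =
        -(Real.log n * 2) by ring, Real.exp_neg, ← Real.rpow_two, Real.rpow_def_of_pos hn0, one_div]
    have hup := measure_ge_le_exp_mul_mgf (X := A n) (μ := μ) ((4 + σ / 2) * rate a n) hl0
      (hexpint l)
    have hlo := measure_le_le_exp_mul_mgf (X := A n) (μ := μ) (-((4 + σ / 2) * rate a n))
      (neg_nonpos.2 hl0) (hexpint (-l))
    have e1 : -l * ((4 + σ / 2) * rate a n) = -((4 + σ / 2) * (Real.log n / 2)) := by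
      rw [← hlr]; ring
    have e2 : - -l * -((4 + σ / 2) * rate a n) = -((4 + σ / 2) * (Real.log n / 2)) := by
      rw [← hlr]; ring
    rw [e1] at hup
    rw [e2] at hlo
    have hup' := hup.trans (mul_le_mul_of_nonneg_left (hval l (abs_of_nonneg hl0))
      (Real.exp_pos _).le)
    have hlo' := hlo.trans (mul_le_mul_of_nonneg_left
      (hval (-l) (by rw [abs_neg, abs_of_nonneg hl0])) (Real.exp_pos _).le)
    rw [hsmall] at hup' hlo'
    refine (measureReal_union_le _ _).trans ?_
    linarith
  -- truncation changes only finitely many terms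
  have hlarge : ∀ᵐ ω ∂μ, ∀ᶠ n in atTop,
      ω ∉ {ω | (rate a (n + 1))⁻¹ ^ q ≤ |ζ n ω| ^ q} := by
    refine ae_eventually_notMem_of_real_le
      (((summable_nat_add_iff 1).2 hsum).mul_left K) ?_
    filter_upwards [hs.eventually ha.eventually_rate_pos] with n hr
    have h1 := mul_meas_ge_le_integral_of_nonneg (μ := μ)
      (ae_of_all _ fun ω => Real.rpow_nonneg (abs_nonneg (ζ n ω)) q) (hintq n)
      ((rate a (n + 1))⁻¹ ^ q)
    have h2 : ∫ ω, |ζ n ω| ^ q ∂μ ≤ K := by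
      rw [← integral_condExp (ℱ.le n)]
      calc _ ≤ ∫ _, K ∂μ := integral_mono_ae integrable_condExp (integrable_const _) (hK n)
        _ = K := by simp
    have hrq : 0 < rate a (n + 1) ^ q := Real.rpow_pos_of_pos hr q
    rw [Real.inv_rpow hr.le] at h1 ⊢
    rw [inv_mul_le_iff₀ hrq] at h1
    calc _ ≤ rate a (n + 1) ^ q * ∫ ω, |ζ n ω| ^ q ∂μ := h1
      _ ≤ _ := by rw [mul_comm]; gcongr
  have hbias : ∀ᵐ ω ∂μ, ∀ n, N ≤ n → |(μ[T n|ℱ n]) ω| ≤ K * rate a (n + 1) := by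
    rw [ae_all_iff]
    intro n
    by_cases hn : N ≤ n
    · filter_upwards [ae_abs_condExp_trunc_le hq (hζ' n) (hint n) (hintq n) (h0 n)
        (hK n) (hN n hn).2.1 (hN n hn).2.2.1] with ω hω _
      exact hω
    · exact ae_of_all _ fun ω h => absurd h hn
  filter_upwards [htail, hlarge, hbias] with ω h1 h2 h3
  obtain ⟨B, hB0, hB⟩ := ha.isBigO_rate_of_recursion (x := fun n => |M n ω - A n ω|) (K := K) (by
    filter_upwards [h2, eventually_ge_atTop N] with n hn hn'
    obtain ⟨g1, g2, -⟩ := hN n hn'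
    have hp := ha.pos n
    have htr : T n ω = ζ n ω := by
      refine if_pos (le_of_not_gt fun hgt => hn ?_)
      exact Real.rpow_le_rpow (hτ n) hgt.le (by linarith)
    have e : M (n + 1) ω - A (n + 1) ω =
        (1 - a (n + 1)) * (M n ω - A n ω) + a (n + 1) * (μ[T n|ℱ n]) ω := by
      rw [hM, hA, avgFrom_succ a hn']
      simp only [hw, htr]
      ring
    rw [e]
    refine (abs_add_le _ _).trans ?_
    rw [abs_mul, abs_mul, abs_of_pos hp, abs_of_nonneg (by linarith)]
    have := abs_nonneg (M n ω - A n ω)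
    have h4 := mul_le_mul_of_nonneg_left (h3 n hn') hp.le
    nlinarith [mul_nonneg hp.le this])
  refine ⟨B + (4 + σ / 2), by positivity, ?_⟩
  filter_upwards [h1, hB] with n g1 g2
  simp only [Set.mem_union, Set.mem_ofPred_eq, not_or, not_le] at g1
  have h5 : |A n ω| ≤ (4 + σ / 2) * rate a n := abs_le.2 ⟨g1.2.le, g1.1.le⟩
  have h6 := abs_add_le (M n ω - A n ω) (A n ω)
  rw [sub_add_cancel] at h6
  linarith

end RecursiveAverage

/-! ### Integrating out an independent variable -/

section Independence

variable {Ω 𝒳 T : Type*} {m mΩ : MeasurableSpace Ω} [MeasurableSpace 𝒳] [MeasurableSpace T]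
  {μ : Measure Ω} [IsProbabilityMeasure μ] {P : Measure 𝒳}
  {X : Ω → 𝒳} {Z : Ω → T} {f : 𝒳 × T → ℝ}

theorem map_prodMk_of_indep (hm : m ≤ mΩ) (hX : Measurable[mΩ] X) (hlaw : μ.map X = P)
    (hind : Indep (MeasurableSpace.comap X inferInstance) m μ) (hZ : Measurable[m] Z) :
    μ.map (fun ω => (X ω, Z ω)) = P.prod (μ.map Z) := by
  have h : IndepFun X Z μ := by
    rw [IndepFun_iff_Indep]
    exact indep_of_indep_of_le_right hind hZ.comap_le
  rw [(indepFun_iff_map_prod_eq_prod_map_map hX.aemeasurable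
    (hZ.mono hm le_rfl).aemeasurable).1 h, hlaw]

variable [IsProbabilityMeasure P]

theorem integrable_comp_of_indep (hm : m ≤ mΩ) (hX : Measurable[mΩ] X) (hlaw : μ.map X = P)
    (hind : Indep (MeasurableSpace.comap X inferInstance) m μ) (hZ : Measurable[m] Z)
    (hf : Measurable f) (hfx : ∀ t, Integrable (fun x => f (x, t)) P)
    {b : Ω → ℝ} (hb : Integrable b μ) (hfb : ∀ᵐ ω ∂μ, ∫ x, ‖f (x, Z ω)‖ ∂P ≤ b ω) :
    Integrable (fun ω => f (X ω, Z ω)) μ := by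
  have hZ' : Measurable[mΩ] Z := hZ.mono hm le_rfl
  have hmap := map_prodMk_of_indep hm hX hlaw hind hZ
  have hZp : IsProbabilityMeasure (μ.map Z) := Measure.isProbabilityMeasure_map hZ'.aemeasurable
  have hI : Measurable (fun t => ∫ x, ‖f (x, t)‖ ∂P) :=
    (hf.norm.stronglyMeasurable.integral_prod_left' (μ := P)).measurable
  have h1 : Integrable f (P.prod (μ.map Z)) := by
    rw [integrable_prod_iff' hf.aestronglyMeasurable]
    refine ⟨ae_of_all _ hfx, ?_⟩
    rw [integrable_map_measure hI.aestronglyMeasurable hZ'.aemeasurable]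
    refine hb.mono' (hI.comp hZ').aestronglyMeasurable ?_
    filter_upwards [hfb] with ω hω
    rwa [Function.comp, Real.norm_eq_abs,
      abs_of_nonneg (integral_nonneg fun _ => norm_nonneg _)]
  rw [← hmap, integrable_map_measure hf.aestronglyMeasurable (hX.prodMk hZ').aemeasurable] at h1
  exact h1

theorem integral_comp_of_indep (hm : m ≤ mΩ) (hX : Measurable[mΩ] X) (hlaw : μ.map X = P)
    (hind : Indep (MeasurableSpace.comap X inferInstance) m μ) (hZ : Measurable[m] Z)
    (hf : Measurable f) (hint : Integrable (fun ω => f (X ω, Z ω)) μ) :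
    Integrable (fun ω => ∫ x, f (x, Z ω) ∂P) μ ∧
      ∫ ω, f (X ω, Z ω) ∂μ = ∫ ω, ∫ x, f (x, Z ω) ∂P ∂μ := by
  have hZ' : Measurable[mΩ] Z := hZ.mono hm le_rfl
  have hmap := map_prodMk_of_indep hm hX hlaw hind hZ
  have hZp : IsProbabilityMeasure (μ.map Z) := Measure.isProbabilityMeasure_map hZ'.aemeasurable
  have hI : Measurable (fun t => ∫ x, f (x, t) ∂P) :=
    (hf.stronglyMeasurable.integral_prod_left' (μ := P)).measurable
  have h1 : Integrable f (P.prod (μ.map Z)) := by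
    rw [← hmap, integrable_map_measure hf.aestronglyMeasurable (hX.prodMk hZ').aemeasurable]
    exact hint
  constructor
  · have h2 := h1.integral_prod_right
    rw [integrable_map_measure hI.aestronglyMeasurable hZ'.aemeasurable] at h2
    exact h2
  · calc ∫ ω, f (X ω, Z ω) ∂μ = ∫ p, f p ∂(μ.map (fun ω => (X ω, Z ω))) :=
          (integral_map (hX.prodMk hZ').aemeasurable hf.aestronglyMeasurable).symm
      _ = ∫ t, ∫ x, f (x, t) ∂P ∂(μ.map Z) := by rw [hmap, integral_prod_symm f h1]
      _ = _ := integral_map hZ'.aemeasurable hI.aestronglyMeasurable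

/-- Freezing: if `X` is independent of `m` and `Z` is `m`-measurable, the conditional expectation
of `f (X, Z)` given `m` is obtained by integrating over the law of `X` with `Z` fixed. -/
theorem condExp_comp_of_indep (hm : m ≤ mΩ) (hX : Measurable[mΩ] X) (hlaw : μ.map X = P)
    (hind : Indep (MeasurableSpace.comap X inferInstance) m μ) (hZ : Measurable[m] Z)
    (hf : Measurable f) (hint : Integrable (fun ω => f (X ω, Z ω)) μ) :
    μ[fun ω => f (X ω, Z ω)|m] =ᵐ[μ] fun ω => ∫ x, f (x, Z ω) ∂P := by
  have hI : Measurable (fun t => ∫ x, f (x, t) ∂P) :=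
    (hf.stronglyMeasurable.integral_prod_left' (μ := P)).measurable
  symm
  refine ae_eq_condExp_of_forall_setIntegral_eq hm hint (fun s _ _ =>
    (integral_comp_of_indep hm hX hlaw hind hZ hf hint).1.integrableOn) (fun s hs _ => ?_)
    (hI.comp hZ).stronglyMeasurable.aestronglyMeasurable
  -- the indicator of `s` is adjoined to the frozen variable
  have hs' : MeasurableSet[mΩ] s := hm s hs
  let i : Ω → ℝ := s.indicator 1
  have hi : Measurable[m] i := (stronglyMeasurable_one.indicator hs).measurable
  have key := (integral_comp_of_indep (Z := fun ω => (Z ω, i ω))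
    (f := fun p => p.2.2 * f (p.1, p.2.1)) hm hX hlaw hind (hZ.prodMk hi) (by fun_prop) ?_).2
  · rw [← integral_indicator hs', ← integral_indicator hs']
    simp only [integral_const_mul] at key
    refine Eq.trans (integral_congr_ae (ae_of_all _ fun ω => ?_))
      (key.symm.trans (integral_congr_ae (ae_of_all _ fun ω => ?_)))
    all_goals by_cases h : ω ∈ s <;> simp [i, h]
  · refine (hint.indicator hs').congr (ae_of_all _ fun ω => ?_)
    by_cases h : ω ∈ s <;> simp [i, h]

end Independence

/-! ### Differentiation under the expectation -/

section Gradient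

/-- Convergence of expectations for almost everywhere convergent sequences bounded in `L²`. -/
theorem tendsto_integral_of_sq_bounded {α : Type*} [MeasurableSpace α] {P : Measure α}
    [IsProbabilityMeasure P] {f : ℕ → α → ℝ} {f₀ : α → ℝ} {C : ℝ}
    (hf : ∀ n, Integrable (f n) P) (hf₀ : Integrable f₀ P)
    (hf2 : ∀ n, Integrable (fun x => f n x ^ 2) P) (hf₀2 : Integrable (fun x => f₀ x ^ 2) P)
    (hC : ∀ n, ∫ x, f n x ^ 2 ∂P ≤ C)
    (hlim : ∀ᵐ x ∂P, Tendsto (fun n => f n x) atTop (𝓝 (f₀ x))) :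
    Tendsto (fun n => ∫ x, f n x ∂P) atTop (𝓝 (∫ x, f₀ x ∂P)) := by
  set D := 2 * C + 2 * ∫ x, f₀ x ^ 2 ∂P with hD
  have hD0 : 0 ≤ D := by
    have h1 : 0 ≤ ∫ x, f 0 x ^ 2 ∂P := integral_nonneg fun _ => sq_nonneg _
    have h2 : 0 ≤ ∫ x, f₀ x ^ 2 ∂P := integral_nonneg fun _ => sq_nonneg _
    have := hC 0
    linarith
  rw [Metric.tendsto_atTop]
  intro ε hε
  -- `|u| ≤ min |u| R + u² / R`: the first part is handled by dominated convergence
  set R := 2 * D / ε + 1 with hR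
  have hR0 : 0 < R := by positivity
  have hmin : Tendsto (fun n => ∫ x, min |f n x - f₀ x| R ∂P) atTop (𝓝 (∫ _, (0 : ℝ) ∂P)) := by
    refine tendsto_integral_of_dominated_convergence (fun _ => R) (fun n => ?_)
      (integrable_const _) (fun n => ae_of_all _ fun x => ?_) ?_
    · exact (((hf n).sub hf₀).abs.inf (integrable_const R)).aestronglyMeasurable
    · rw [Real.norm_eq_abs, abs_of_nonneg (le_min (abs_nonneg _) hR0.le)]
      exact min_le_right _ _
    · filter_upwards [hlim] with x hx
      have h1 : Tendsto (fun n => |f n x - f₀ x|) atTop (𝓝 0) := by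
        simpa using (hx.sub_const (f₀ x)).abs
      simpa [hR0.le] using h1.min (tendsto_const_nhds (x := R))
  rw [integral_zero] at hmin
  obtain ⟨N, hN⟩ := eventually_atTop.1 (hmin.eventually_lt_const (half_pos hε))
  refine ⟨N, fun n hn => ?_⟩
  have hsub2 : Integrable (fun x => (f n x - f₀ x) ^ 2) P := by
    refine (((hf2 n).const_mul 2).add (hf₀2.const_mul 2)).mono'
      (((hf n).sub hf₀).aestronglyMeasurable.pow 2) (ae_of_all _ fun x => ?_)
    rw [Real.norm_eq_abs, abs_of_nonneg (sq_nonneg _)]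
    simp only [Pi.add_apply]
    nlinarith [sq_nonneg (f n x + f₀ x)]
  have hsq : ∫ x, (f n x - f₀ x) ^ 2 ∂P ≤ D := by
    calc _ ≤ ∫ x, (2 * f n x ^ 2 + 2 * f₀ x ^ 2) ∂P :=
          integral_mono hsub2 (((hf2 n).const_mul 2).add (hf₀2.const_mul 2)) fun x => by
            nlinarith [sq_nonneg (f n x + f₀ x)]
      _ = 2 * ∫ x, f n x ^ 2 ∂P + 2 * ∫ x, f₀ x ^ 2 ∂P := by
          rw [integral_add ((hf2 n).const_mul 2) (hf₀2.const_mul 2), integral_const_mul,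
            integral_const_mul]
      _ ≤ D := by linarith [hC n]
  have hpt : ∀ x, |f n x - f₀ x| ≤ min |f n x - f₀ x| R + R⁻¹ * (f n x - f₀ x) ^ 2 := by
    intro x
    rcases le_total |f n x - f₀ x| R with h | h
    · rw [min_eq_left h]
      have : 0 ≤ R⁻¹ * (f n x - f₀ x) ^ 2 := by positivity
      linarith
    · have : |f n x - f₀ x| ≤ R⁻¹ * (f n x - f₀ x) ^ 2 := by
        rw [← sq_abs, inv_mul_eq_div, le_div_iff₀ hR0]
        nlinarith [abs_nonneg (f n x - f₀ x)]
      have h2 : 0 ≤ min |f n x - f₀ x| R := le_min (abs_nonneg _) hR0.le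
      linarith
  have hminint : Integrable (fun x => min |f n x - f₀ x| R) P :=
    ((hf n).sub hf₀).abs.inf (integrable_const R)
  rw [Real.dist_eq, ← integral_sub (hf n) hf₀]
  calc |∫ x, (f n x - f₀ x) ∂P| ≤ ∫ x, |f n x - f₀ x| ∂P := abs_integral_le_integral_abs
    _ ≤ ∫ x, (min |f n x - f₀ x| R + R⁻¹ * (f n x - f₀ x) ^ 2) ∂P :=
        integral_mono ((hf n).sub hf₀).abs (hminint.add (hsub2.const_mul _)) hpt
    _ = ∫ x, min |f n x - f₀ x| R ∂P + R⁻¹ * ∫ x, (f n x - f₀ x) ^ 2 ∂P := by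
        rw [integral_add hminint (hsub2.const_mul _), integral_const_mul]
    _ < ε / 2 + ε / 2 := by
        refine add_lt_add_of_lt_of_le (hN n hn) ?_
        rw [inv_mul_eq_div, div_le_iff₀ hR0, hR]
        have : ε / 2 * (2 * D / ε + 1) = D + ε / 2 := by field_simp
        rw [this]; linarith
    _ = ε := add_halves ε

variable {d : ℕ} {𝒳 : Type*} [MeasurableSpace 𝒳] {P : Measure 𝒳}
  {g : 𝒳 → EuclideanSpace ℝ (Fin d) → ℝ}

theorem gradient_apply_eq_fderiv (G : EuclideanSpace ℝ (Fin d) → ℝ)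
    (h : EuclideanSpace ℝ (Fin d)) (i : Fin d) :
    gradient G h i = fderiv ℝ G h (EuclideanSpace.single i 1) := by
  rw [← inner_gradient_eq_fderiv, EuclideanSpace.inner_single_right]
  simp

/-- Off a null set of samples the stochastic gradient agrees with a jointly measurable function.
On the null set where `g x` is not differentiable, `gradient (g x)` need not be measurable. -/
theorem exists_measurable_gradient (hg : Measurable (Function.uncurry g))
    (hdiff : ∀ᵐ x ∂P, Differentiable ℝ (g x)) :
    ∃ D : 𝒳 → EuclideanSpace ℝ (Fin d) → EuclideanSpace ℝ (Fin d),
      Measurable (Function.uncurry D) ∧ ∀ᵐ x ∂P, ∀ h, D x h = gradient (g x) h := by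
  classical
  obtain ⟨s, hsP, hs, hsd⟩ := hdiff.exists_measurable_mem
  refine ⟨fun x h => if x ∈ s then gradient (g x) h else 0, ?_, ?_⟩
  · have hcoord : ∀ i, Measurable (fun p : 𝒳 × EuclideanSpace ℝ (Fin d) =>
        (if p.1 ∈ s then gradient (g p.1) p.2 else 0) i) := by
      intro i
      set e : EuclideanSpace ℝ (Fin d) := EuclideanSpace.single i 1 with he
      refine measurable_of_tendsto_metrizable (f := fun (n : ℕ) p =>
        if p.1 ∈ s then (n : ℝ) * (g p.1 (p.2 + (n : ℝ)⁻¹ • e) - g p.1 p.2) else 0)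
        (fun n => ?_) ?_
      · refine Measurable.ite (measurable_fst hs) (Measurable.const_mul (Measurable.sub ?_ hg) _)
          measurable_const
        exact hg.comp (measurable_fst.prodMk (measurable_snd.add_const _))
      · rw [tendsto_pi_nhds]
        intro p
        by_cases hp : p.1 ∈ s
        · simp only [hp, if_true]
          have h1 := ((hsd p.1 hp) p.2).hasFDerivAt.lim e (c := fun n : ℕ => (n : ℝ)) (l := atTop)
            (by simpa using tendsto_natCast_atTop_atTop (R := ℝ))
          rw [gradient_apply_eq_fderiv]
          simpa using h1
        · simp [hp]
    exact (WithLp.measurable_toLp 2 _).comp (measurable_pi_iff.2 hcoord)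
  · filter_upwards [hsP] with x hx h
    simp [hx]

end Gradient

section GradientOfRisk

variable {d : ℕ} {𝒳 : Type*} [MeasurableSpace 𝒳] {P : Measure 𝒳} [IsProbabilityMeasure P]
  {g : 𝒳 → EuclideanSpace ℝ (Fin d) → ℝ}
  {D : 𝒳 → EuclideanSpace ℝ (Fin d) → EuclideanSpace ℝ (Fin d)}

/-- The increments of `g x` are bounded in `L²` by those of the gradient along the segment, by the
fundamental theorem of calculus on almost every segment and Fubini. -/
theorem integral_sq_increment_le (hD : Measurable (Function.uncurry D))
    (hae : ∀ᵐ x ∂P, Differentiable ℝ (g x) ∧ ∀ h, D x h = gradient (g x) h)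
    (hg_int : ∀ h, Integrable (fun x => g x h) P)
    (hsq : ∀ h, Integrable (fun x => ‖D x h‖ ^ 2) P) (h u : EuclideanSpace ℝ (Fin d)) {C : ℝ}
    (hC : ∀ s ∈ Set.Ioc (0 : ℝ) 1, ∫ x, ‖D x (h + s • u)‖ ^ 2 ∂P ≤ C) :
    Integrable (fun x => (g x (h + u) - g x h) ^ 2) P ∧
      ∫ x, (g x (h + u) - g x h) ^ 2 ∂P ≤ ‖u‖ ^ 2 * C := by
  set ν : Measure ℝ := volume.restrict (Set.Ioc 0 1) with hν
  have hνp : IsProbabilityMeasure ν := ⟨by simp [hν]⟩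
  set k : 𝒳 × ℝ → ℝ := fun p => inner ℝ (D p.1 (h + p.2 • u)) u with hk
  have hDm : Measurable (fun p : 𝒳 × ℝ => D p.1 (h + p.2 • u)) :=
    hD.comp (measurable_fst.prodMk (by fun_prop))
  have hkm : Measurable k := hDm.inner measurable_const
  have hkle : ∀ p : 𝒳 × ℝ, k p ^ 2 ≤ ‖u‖ ^ 2 * ‖D p.1 (h + p.2 • u)‖ ^ 2 := by
    intro p
    rw [← sq_abs, ← mul_pow, mul_comm ‖u‖]
    exact pow_le_pow_left₀ (abs_nonneg _) (abs_real_inner_le_norm _ _) 2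
  have hks : ∀ s, Integrable (fun x => k (x, s) ^ 2) P := by
    intro s
    refine ((hsq (h + s • u)).const_mul (‖u‖ ^ 2)).mono'
      ((hkm.comp measurable_prodMk_right).pow_const 2).aestronglyMeasurable
      (ae_of_all _ fun x => ?_)
    rw [Real.norm_eq_abs, abs_of_nonneg (sq_nonneg _)]
    exact hkle (x, s)
  have hkC : ∀ᵐ s ∂ν, ∫ x, k (x, s) ^ 2 ∂P ≤ ‖u‖ ^ 2 * C := by
    rw [hν, ae_restrict_iff' measurableSet_Ioc]
    refine ae_of_all _ fun s hs => ?_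
    calc ∫ x, k (x, s) ^ 2 ∂P ≤ ∫ x, ‖u‖ ^ 2 * ‖D x (h + s • u)‖ ^ 2 ∂P :=
          integral_mono (hks s) ((hsq _).const_mul _) fun x => hkle (x, s)
      _ ≤ _ := by
          rw [integral_const_mul]
          exact mul_le_mul_of_nonneg_left (hC s hs) (sq_nonneg _)
  have hIm : Measurable (fun s => ∫ x, k (x, s) ^ 2 ∂P) :=
    ((hkm.pow_const 2).stronglyMeasurable.integral_prod_left' (μ := P)).measurable
  have hIint : Integrable (fun s => ∫ x, k (x, s) ^ 2 ∂P) ν := by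
    refine (integrable_const (‖u‖ ^ 2 * C)).mono' hIm.aestronglyMeasurable ?_
    filter_upwards [hkC] with s hs
    rwa [Real.norm_eq_abs, abs_of_nonneg (integral_nonneg fun _ => sq_nonneg _)]
  have hk2 : Integrable (fun p => k p ^ 2) (P.prod ν) := by
    rw [integrable_prod_iff' (hkm.pow_const 2).aestronglyMeasurable]
    refine ⟨ae_of_all _ hks, ?_⟩
    simpa only [Real.norm_eq_abs, abs_of_nonneg (sq_nonneg (k _))] using hIint
  have hle : ∀ᵐ x ∂P, (g x (h + u) - g x h) ^ 2 ≤ ∫ s, k (x, s) ^ 2 ∂ν := by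
    filter_upwards [hk2.prod_right_ae, hae] with x hx hgx
    have hkint : Integrable (fun s => k (x, s)) ν := by
      refine ((integrable_const (1 : ℝ)).add hx).mono'
        (hkm.comp measurable_prodMk_left).aestronglyMeasurable (ae_of_all _ fun s => ?_)
      simp only [Pi.add_apply, Real.norm_eq_abs]
      nlinarith [sq_nonneg (|k (x, s)| - 1), sq_abs (k (x, s))]
    have hftc : ∫ s in (0 : ℝ)..1, k (x, s) = g x (h + u) - g x h := by
      have h1 := intervalIntegral.integral_eq_sub_of_hasDerivAt (a := 0) (b := 1)
        (f := fun s : ℝ => g x (h + s • u)) (f' := fun s => k (x, s)) (fun s _ => ?_)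
        ((intervalIntegrable_iff_integrableOn_Ioc_of_le zero_le_one).2 hkint)
      · simpa using h1
      · simp only [hk, hgx.2, inner_gradient_eq_fderiv]
        have h2 : HasDerivAt (fun s : ℝ => h + s • u) u s := by
          simpa using ((hasDerivAt_id s).smul_const u).const_add h
        exact (hgx.1 _).hasFDerivAt.comp_hasDerivAt s h2
    rw [intervalIntegral.integral_of_le zero_le_one] at hftc
    rw [← hftc]
    exact (even_two.convexOn_pow (𝕜 := ℝ)).map_integral_le (continuousOn_pow 2) isClosed_univ
      (ae_of_all _ fun _ => Set.mem_univ _) hkint hx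
  have hint : Integrable (fun x => (g x (h + u) - g x h) ^ 2) P := by
    refine hk2.integral_prod_left.mono'
      (((hg_int _).sub (hg_int _)).aestronglyMeasurable.pow 2) ?_
    filter_upwards [hle] with x hx
    rwa [Real.norm_eq_abs, abs_of_nonneg (sq_nonneg _)]
  refine ⟨hint, ?_⟩
  calc ∫ x, (g x (h + u) - g x h) ^ 2 ∂P ≤ ∫ x, ∫ s, k (x, s) ^ 2 ∂ν ∂P :=
        integral_mono_ae hint hk2.integral_prod_left hle
    _ = ∫ s, ∫ x, k (x, s) ^ 2 ∂P ∂ν := integral_integral_swap hk2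
    _ ≤ ∫ _, ‖u‖ ^ 2 * C ∂ν := integral_mono_ae hIint (integrable_const _) hkC
    _ = _ := by simp

/-- `∇G(h) = E[∇g(X, h)]`. No continuity of the stochastic gradient is assumed: the difference
quotients converge almost surely and are bounded in `L²`. -/
theorem integral_inner_gradient_eq (hD : Measurable (Function.uncurry D))
    (hae : ∀ᵐ x ∂P, Differentiable ℝ (g x) ∧ ∀ h, D x h = gradient (g x) h)
    (hg_int : ∀ h, Integrable (fun x => g x h) P)
    (hsq : ∀ h, Integrable (fun x => ‖D x h‖ ^ 2) P)
    {ψ : EuclideanSpace ℝ (Fin d) → ℝ} (hψ : Continuous ψ)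
    (hle : ∀ h, ∫ x, ‖D x h‖ ^ 2 ∂P ≤ ψ h) (hG : Differentiable ℝ (risk P g))
    (h v : EuclideanSpace ℝ (Fin d)) :
    Integrable (fun x => inner ℝ (D x h) v) P ∧
      ∫ x, inner ℝ (D x h) v ∂P = inner ℝ (gradient (risk P g) h) v := by
  have hDh : Measurable (fun x => D x h) := hD.comp measurable_prodMk_right
  have hDi : Measurable (fun x => inner ℝ (D x h) v) := hDh.inner measurable_const
  have hDsq : Integrable (fun x => (inner ℝ (D x h) v) ^ 2) P := by
    refine ((hsq h).mul_const (‖v‖ ^ 2)).mono' (hDi.pow_const 2).aestronglyMeasurable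
      (ae_of_all _ fun x => ?_)
    rw [Real.norm_eq_abs, abs_of_nonneg (sq_nonneg _), ← sq_abs, ← mul_pow]
    exact pow_le_pow_left₀ (abs_nonneg _) (abs_real_inner_le_norm _ _) 2
  have hDint : Integrable (fun x => inner ℝ (D x h) v) P := by
    refine ((integrable_const (1 : ℝ)).add hDsq).mono' hDi.aestronglyMeasurable
      (ae_of_all _ fun x => ?_)
    simp only [Pi.add_apply, Real.norm_eq_abs]
    nlinarith [sq_nonneg (|(inner ℝ (D x h) v : ℝ)| - 1), sq_abs (inner ℝ (D x h) v : ℝ)]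
  refine ⟨hDint, ?_⟩
  let t : ℕ → ℝ := fun n => (n : ℝ) + 1
  have ht : ∀ n, 1 ≤ t n := fun n => by simp [t]
  have htlim : Tendsto (fun n => ‖t n‖) atTop atTop :=
    tendsto_norm_atTop_atTop.comp (tendsto_atTop_add_const_right _ _ tendsto_natCast_atTop_atTop)
  let f : ℕ → 𝒳 → ℝ := fun n x => t n * (g x (h + (t n)⁻¹ • v) - g x h)
  -- a bound for `ψ` on the segment containing all the increments
  obtain ⟨C, hC⟩ := (isCompact_closedBall h ‖v‖).bddAbove_image hψ.continuousOn
  have hCseg : ∀ n, ∀ s ∈ Set.Ioc (0 : ℝ) 1,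
      ∫ x, ‖D x (h + s • ((t n)⁻¹ • v))‖ ^ 2 ∂P ≤ C := by
    intro n s hs
    refine (hle _).trans (hC ⟨_, ?_, rfl⟩)
    rw [mem_closedBall_iff_norm, add_sub_cancel_left, norm_smul, norm_smul, Real.norm_eq_abs,
      Real.norm_eq_abs, abs_of_pos hs.1, abs_of_nonneg (by have := ht n; positivity)]
    have h1 : (t n)⁻¹ ≤ 1 := inv_le_one_of_one_le₀ (ht n)
    have h2 : 0 ≤ (t n)⁻¹ := by have := ht n; positivity
    calc s * ((t n)⁻¹ * ‖v‖) ≤ 1 * (1 * ‖v‖) := by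
          gcongr
          exact hs.2
      _ = ‖v‖ := by ring
  have hinc := fun n => integral_sq_increment_le hD hae hg_int hsq h ((t n)⁻¹ • v) (hCseg n)
  have hlim : Tendsto (fun n => ∫ x, f n x ∂P) atTop (𝓝 (∫ x, inner ℝ (D x h) v ∂P)) := by
    refine tendsto_integral_of_sq_bounded (C := ‖v‖ ^ 2 * C)
      (fun n => ((hg_int _).sub (hg_int _)).const_mul _) hDint (fun n => ?_) hDsq (fun n => ?_) ?_
    · simpa only [f, mul_pow] using (hinc n).1.const_mul (t n ^ 2)
    · simp only [f, mul_pow]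
      rw [integral_const_mul]
      have htn : 0 < t n := lt_of_lt_of_le one_pos (ht n)
      calc t n ^ 2 * ∫ x, (g x (h + (t n)⁻¹ • v) - g x h) ^ 2 ∂P
          ≤ t n ^ 2 * (‖(t n)⁻¹ • v‖ ^ 2 * C) :=
            mul_le_mul_of_nonneg_left (hinc n).2 (sq_nonneg _)
        _ = ‖v‖ ^ 2 * C := by
            rw [norm_smul, Real.norm_eq_abs, abs_of_pos (inv_pos.2 htn)]
            field_simp
    · filter_upwards [hae] with x hx
      rw [hx.2, inner_gradient_eq_fderiv]
      exact (hx.1 h).hasFDerivAt.lim v htlim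
  have hlim' : Tendsto (fun n => ∫ x, f n x ∂P) atTop (𝓝 (fderiv ℝ (risk P g) h v)) := by
    have h1 := (hG h).hasFDerivAt.lim v htlim
    refine h1.congr fun n => ?_
    simp only [f, risk]
    rw [integral_const_mul, integral_sub (hg_int _) (hg_int _), smul_eq_mul]
  rw [inner_gradient_eq_fderiv]
  exact tendsto_nhds_unique hlim hlim'

end GradientOfRisk

/-! ### Almost sure convergence of the iterates -/

section Supermartingale

variable {Ω : Type*} {mΩ : MeasurableSpace Ω} {μ : Measure Ω} [IsProbabilityMeasure μ]
  {ℱ : Filtration ℕ mΩ}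

theorem ae_tendsto_of_nonneg_supermartingale {Q : ℕ → Ω → ℝ}
    (hQm : ∀ n, StronglyMeasurable[ℱ n] (Q n)) (hQ0 : ∀ n ω, 0 ≤ Q n ω)
    (hQi : ∀ n, Integrable (Q n) μ) (hQ : ∀ n, μ[Q (n + 1)|ℱ n] ≤ᵐ[μ] Q n) :
    ∀ᵐ ω ∂μ, ∃ l, Tendsto (fun n => Q n ω) atTop (𝓝 l) := by
  have hsuper : Supermartingale Q ℱ μ := supermartingale_nat hQm hQi hQ
  have hanti : ∀ n, ∫ ω, Q n ω ∂μ ≤ ∫ ω, Q 0 ω ∂μ := by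
    intro n
    have h := hsuper.setIntegral_le (Nat.zero_le n) (MeasurableSet.univ)
    simpa using h
  have h := hsuper.neg.exists_ae_tendsto_of_bdd (R := (∫ ω, Q 0 ω ∂μ).toNNReal) (fun n => by
    rw [Pi.neg_apply, eLpNorm_neg, eLpNorm_one_eq_lintegral_enorm,
      ← ofReal_integral_norm_eq_lintegral_enorm (hQi n)]
    refine ENNReal.ofReal_le_ofReal (le_trans (le_of_eq ?_) (hanti n))
    exact integral_congr_ae (ae_of_all _ fun ω => by simp [abs_of_nonneg (hQ0 n ω)]))
  filter_upwards [h] with ω ⟨l, hl⟩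
  exact ⟨-l, by simpa using hl.neg⟩

/-- The Robbins-Siegmund theorem for a nonnegative process `U` whose conditional expectation
decreases by at least `R n` at time `n`. -/
theorem ae_tendsto_and_summable_of_condExp_le {U R : ℕ → Ω → ℝ}
    (hUm : ∀ n, StronglyMeasurable[ℱ n] (U n)) (hRm : ∀ n, StronglyMeasurable[ℱ n] (R n))
    (hU0 : ∀ n ω, 0 ≤ U n ω) (hR0 : ∀ n ω, 0 ≤ R n ω)
    (hUi : ∀ n, Integrable (U n) μ) (hRi : ∀ n, Integrable (R n) μ)
    (hU : ∀ n, μ[U (n + 1)|ℱ n] ≤ᵐ[μ] U n - R n) :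
    ∀ᵐ ω ∂μ, (∃ l, Tendsto (fun n => U n ω) atTop (𝓝 l)) ∧ Summable (fun n => R n ω) := by
  let S : ℕ → Ω → ℝ := fun n => ∑ k ∈ Finset.range n, R k
  have hSm : ∀ n, StronglyMeasurable[ℱ n] (S (n + 1)) := fun n =>
    Finset.stronglyMeasurable_sum _ fun k hk =>
      (hRm k).mono (ℱ.mono (Nat.lt_succ_iff.1 (Finset.mem_range.1 hk)))
  have hSm' : ∀ n, StronglyMeasurable[ℱ n] (S n) := fun n =>
    Finset.stronglyMeasurable_sum _ fun k hk =>
      (hRm k).mono (ℱ.mono (Finset.mem_range.1 hk).le)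
  have hSi : ∀ n, Integrable (S n) μ := fun n => integrable_finsetSum' _ fun k _ => hRi k
  have h1 := ae_tendsto_of_nonneg_supermartingale hUm hU0 hUi (fun n => by
    filter_upwards [hU n] with ω hω
    have := hR0 n ω
    simp only [Pi.sub_apply] at hω
    linarith)
  have h2 := ae_tendsto_of_nonneg_supermartingale (μ := μ) (Q := fun n => U n + S n)
    (fun n => (hUm n).add (hSm' n))
    (fun n ω => add_nonneg (hU0 n ω) (by
      simp only [S, Finset.sum_apply]
      exact Finset.sum_nonneg fun k _ => hR0 k ω))
    (fun n => (hUi n).add (hSi n)) (fun n => by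
      filter_upwards [hU n, condExp_add (m := ℱ n) (hUi (n + 1)) (hSi (n + 1))] with ω h1 h2
      rw [h2, Pi.add_apply, condExp_of_stronglyMeasurable (ℱ.le n) (hSm n) (hSi (n + 1))]
      simp only [S, Finset.sum_range_succ, Pi.add_apply, Pi.sub_apply] at h1 ⊢
      linarith)
  filter_upwards [h1, h2] with ω ⟨l, hl⟩ ⟨l', hl'⟩
  refine ⟨⟨l, hl⟩, ?_⟩
  have h3 : Tendsto (fun n => ∑ k ∈ Finset.range n, R k ω) atTop (𝓝 (l' - l)) := by
    refine (hl'.sub hl).congr fun n => ?_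
    simp [S]
  exact ((hasSum_iff_tendsto_nat_of_nonneg (fun n => hR0 n ω) _).2 h3).summable

end Supermartingale

theorem tendsto_of_summable_sq_gradient {d : ℕ} {G : EuclideanSpace ℝ (Fin d) → ℝ}
    (hG : ConvexOn ℝ Set.univ G) (hd : Differentiable ℝ G) {θ : EuclideanSpace ℝ (Fin d)}
    {m r : ℝ} (hm : 0 < m) (hr : 0 < r)
    (hgrow : ∀ ε, 0 < ε → ε ≤ r → ∀ h, ε ≤ ‖h - θ‖ → m * ε * ‖h - θ‖ ≤ G h - G θ)
    {a : ℕ → ℝ} (ha : SlowStep a) {y : ℕ → EuclideanSpace ℝ (Fin d)} {l : ℝ}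
    (hl : Tendsto (fun n => G (y n)) atTop (𝓝 l))
    (hsum : Summable fun n => a (n + 1) * ‖gradient G (y n)‖ ^ 2) :
    Tendsto y atTop (𝓝 θ) := by
  have hgrad : ∀ ε, 0 < ε → ε ≤ r → ∀ h, ε ≤ ‖h - θ‖ → m * ε ≤ ‖gradient G h‖ := by
    intro ε hε hεr h hh
    have h1 := hgrow ε hε hεr h hh
    have h2 := convexOn_add_inner_gradient_le hG hd h θ
    have h3 := (abs_le.1 (abs_real_inner_le_norm (gradient G h) (θ - h))).1
    rw [norm_sub_rev θ h] at h3
    exact le_of_mul_le_mul_right (by linarith) (hε.trans_le hh)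
  -- the iterates come arbitrarily close to `θ` infinitely often, as the steps are not summable
  have hfreq : ∀ ε, 0 < ε → ε ≤ r → ∃ᶠ n in atTop, ‖y n - θ‖ < ε := by
    intro ε hε hεr hev
    refine ha.not_summable ?_
    refine Summable.of_norm_bounded_eventually_nat (hsum.mul_left ((m * ε) ^ 2)⁻¹) ?_
    filter_upwards [hev] with n hn
    have h1 := hgrad ε hε hεr (y n) (not_lt.1 hn)
    have hp := ha.pos n
    have h2 : (m * ε) ^ 2 ≤ ‖gradient G (y n)‖ ^ 2 := pow_le_pow_left₀ (by positivity) h1 2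
    rw [Real.norm_eq_abs, abs_of_pos hp, inv_mul_eq_div, le_div_iff₀ (by positivity)]
    exact mul_le_mul_of_nonneg_left h2 hp.le
  have hlθ : l ≤ G θ := by
    refine le_of_forall_pos_le_add fun δ hδ => ?_
    obtain ⟨ε, hε, hball⟩ := Metric.continuousAt_iff.1 (hd θ).continuousAt δ hδ
    refine le_of_tendsto_of_frequently hl
      ((hfreq (min ε r) (lt_min hε hr) (min_le_right _ _)).mono fun n hn => ?_)
    have h1 := hball (x := y n) (by rw [dist_eq_norm]; exact hn.trans_le (min_le_left _ _))
    rw [Real.dist_eq] at h1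
    linarith [(abs_lt.1 h1).2]
  rw [Metric.tendsto_atTop']
  intro ε hε
  set ε' := min (ε / 2) r with hε'
  have hε'0 : 0 < ε' := lt_min (half_pos hε) hr
  have hpos : 0 < m * ε' * ε' := by positivity
  have hlt : l < G θ + m * ε' * ε' := by linarith
  obtain ⟨N, hN⟩ := eventually_atTop.1 (hl.eventually_lt_const hlt)
  refine ⟨N, fun n hn => ?_⟩
  rw [dist_eq_norm]
  by_contra! hge
  have h1 : ε' ≤ ‖y n - θ‖ := (min_le_left _ _).trans (by linarith)
  have h2 := hgrow ε' hε'0 (min_le_right _ _) (y n) h1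
  have h3 : m * ε' * ε' ≤ m * ε' * ‖y n - θ‖ := mul_le_mul_of_nonneg_left h1 (by positivity)
  linarith [hN n hn.le]

/-- Stochastic gradient descent with random preconditioners: `Y` are the iterates for the steps `a`,
`B n` is the preconditioner at time `n`, `D x h` is an unbiased estimate of the gradient of the
convex function `G` with `L`-Lipschitz gradient and minimizer `θ`, and the excess risk `G - G θ`
controls its second moment through `C` and `C'`. The sample `X (n + 1)` is independent of `ℱ n`, but
need not be `ℱ (n + 1)`-measurable. -/
structure PreconditionedSGD {d : ℕ} {Ω 𝒳 : Type*} {mΩ : MeasurableSpace Ω} [MeasurableSpace 𝒳]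
    (μ : Measure Ω) (P : Measure 𝒳)
    (D : 𝒳 → EuclideanSpace ℝ (Fin d) → EuclideanSpace ℝ (Fin d))
    (G : EuclideanSpace ℝ (Fin d) → ℝ) (θ : EuclideanSpace ℝ (Fin d)) (X : ℕ → Ω → 𝒳)
    (ℱ : Filtration ℕ mΩ) (a : ℕ → ℝ) (Y : ℕ → Ω → EuclideanSpace ℝ (Fin d))
    (B : ℕ → Ω → EuclideanSpace ℝ (Fin d) →L[ℝ] EuclideanSpace ℝ (Fin d)) (L C C' : ℝ) :
    Prop where
  measurable_D : Measurable (Function.uncurry D)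
  integrable_inner : ∀ h v, Integrable (fun x => inner ℝ (D x h) v) P
  integral_inner : ∀ h v, ∫ x, inner ℝ (D x h) v ∂P = inner ℝ (gradient G h) v
  integrable_sq : ∀ h, Integrable (fun x => ‖D x h‖ ^ 2) P
  integral_sq_le : ∀ h, ∫ x, ‖D x h‖ ^ 2 ∂P ≤ C + C' * (G h - G θ)
  C_nonneg : 0 ≤ C
  C'_nonneg : 0 ≤ C'
  convexOn : ConvexOn ℝ Set.univ G
  differentiable : Differentiable ℝ G
  gradient_eq_zero : gradient G θ = 0
  L_nonneg : 0 ≤ L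
  lipschitz : ∀ z w, ‖gradient G z - gradient G w‖ ≤ L * ‖z - w‖
  measurable_X : ∀ n, Measurable (X (n + 1))
  law_X : ∀ n, μ.map (X (n + 1)) = P
  indep : ∀ n, Indep (MeasurableSpace.comap (X (n + 1)) inferInstance) (ℱ n) μ
  measurable_Y : ∀ n, Measurable[ℱ n] (Y n)
  measurable_B : ∀ n, Measurable[ℱ n] (B n)
  slowStep : SlowStep a
  step : ∀ᵐ ω ∂μ, ∀ n, Y (n + 1) ω = Y n ω - a (n + 1) • B n ω (D (X (n + 1) ω) (Y n ω))

theorem measurable_clm_apply {d : ℕ} {α : Type*} {mα : MeasurableSpace α}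
    {A : α → EuclideanSpace ℝ (Fin d) →L[ℝ] EuclideanSpace ℝ (Fin d)}
    {u : α → EuclideanSpace ℝ (Fin d)} (hA : Measurable A) (hu : Measurable u) :
    Measurable fun x => A x (u x) :=
  (isBoundedBilinearMap_apply (𝕜 := ℝ)).continuous.measurable.comp (hA.prodMk hu)

namespace PreconditionedSGD

variable {d : ℕ} {Ω 𝒳 : Type*} {mΩ : MeasurableSpace Ω} [MeasurableSpace 𝒳]
  {μ : Measure Ω} {P : Measure 𝒳}
  {D : 𝒳 → EuclideanSpace ℝ (Fin d) → EuclideanSpace ℝ (Fin d)}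
  {G : EuclideanSpace ℝ (Fin d) → ℝ} {θ : EuclideanSpace ℝ (Fin d)} {X : ℕ → Ω → 𝒳}
  {ℱ : Filtration ℕ mΩ} {a : ℕ → ℝ} {Y : ℕ → Ω → EuclideanSpace ℝ (Fin d)}
  {B : ℕ → Ω → EuclideanSpace ℝ (Fin d) →L[ℝ] EuclideanSpace ℝ (Fin d)} {L C C' : ℝ}

theorem gradient_continuous (M : PreconditionedSGD μ P D G θ X ℱ a Y B L C C') :
    Continuous (gradient G) :=
  (LipschitzWith.of_dist_le_mul (K := ⟨L, M.L_nonneg⟩) fun z w => by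
    rw [dist_eq_norm, dist_eq_norm]; exact M.lipschitz z w).continuous

theorem excess_nonneg (M : PreconditionedSGD μ P D G θ X ℱ a Y B L C C')
    (h : EuclideanSpace ℝ (Fin d)) : 0 ≤ G h - G θ := by
  have := convexOn_add_inner_gradient_le M.convexOn M.differentiable θ h
  rw [M.gradient_eq_zero, inner_zero_left] at this
  linarith

theorem norm_gradient_sq_le [IsProbabilityMeasure P]
    (M : PreconditionedSGD μ P D G θ X ℱ a Y B L C C')
    (h : EuclideanSpace ℝ (Fin d)) : ‖gradient G h‖ ^ 2 ≤ C + C' * (G h - G θ) := by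
  refine le_trans ?_ (M.integral_sq_le h)
  have h1 : ∫ x, (2 * inner ℝ (D x h) (gradient G h) - ‖gradient G h‖ ^ 2) ∂P =
      ‖gradient G h‖ ^ 2 := by
    rw [integral_sub ((M.integrable_inner _ _).const_mul 2) (integrable_const _),
      integral_const_mul, M.integral_inner, real_inner_self_eq_norm_sq]
    simp
    ring
  rw [← h1]
  refine integral_mono (((M.integrable_inner _ _).const_mul 2).sub (integrable_const _))
    (M.integrable_sq h) fun x => ?_
  have h2 := sq_nonneg ‖D x h - gradient G h‖
  rw [norm_sub_sq_real] at h2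
  simp only
  linarith

theorem integral_inner_apply (M : PreconditionedSGD μ P D G θ X ℱ a Y B L C C')
    (A : EuclideanSpace ℝ (Fin d) →L[ℝ] EuclideanSpace ℝ (Fin d))
    (h v : EuclideanSpace ℝ (Fin d)) :
    Integrable (fun x => inner ℝ v (A (D x h))) P ∧
      ∫ x, inner ℝ v (A (D x h)) ∂P = inner ℝ v (A (gradient G h)) := by
  have e : ∀ w, inner ℝ v (A w) = inner ℝ w (ContinuousLinearMap.adjoint A v) := fun w => by
    rw [ContinuousLinearMap.adjoint_inner_right, real_inner_comm]
  simp only [e]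
  exact ⟨M.integrable_inner _ _, M.integral_inner _ _⟩

theorem integral_norm_apply_sq_le (M : PreconditionedSGD μ P D G θ X ℱ a Y B L C C')
    (A : EuclideanSpace ℝ (Fin d) →L[ℝ] EuclideanSpace ℝ (Fin d))
    (h : EuclideanSpace ℝ (Fin d)) :
    Integrable (fun x => ‖A (D x h)‖ ^ 2) P ∧
      ∫ x, ‖A (D x h)‖ ^ 2 ∂P ≤ ‖A‖ ^ 2 * (C + C' * (G h - G θ)) := by
  have hDh : Measurable (fun x => D x h) := M.measurable_D.comp measurable_prodMk_right
  have hle : ∀ x, ‖A (D x h)‖ ^ 2 ≤ ‖A‖ ^ 2 * ‖D x h‖ ^ 2 := fun x => by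
    rw [← mul_pow]
    exact pow_le_pow_left₀ (norm_nonneg _) (A.le_opNorm _) 2
  have hint : Integrable (fun x => ‖A (D x h)‖ ^ 2) P := by
    refine ((M.integrable_sq h).const_mul (‖A‖ ^ 2)).mono'
      ((A.continuous.measurable.comp hDh).norm.pow_const 2).aestronglyMeasurable
      (ae_of_all _ fun x => ?_)
    rw [Real.norm_eq_abs, abs_of_nonneg (sq_nonneg _)]
    exact hle x
  refine ⟨hint, ?_⟩
  calc _ ≤ ∫ x, ‖A‖ ^ 2 * ‖D x h‖ ^ 2 ∂P :=
        integral_mono hint ((M.integrable_sq h).const_mul _) hle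
    _ ≤ _ := by
        rw [integral_const_mul]
        exact mul_le_mul_of_nonneg_left (M.integral_sq_le h) (sq_nonneg _)

/-- The event that up to time `n` the preconditioners and their coercivity constants are controlled
by `K`, with an initial point at distance at most `K` from `θ`. -/
def goodSet (θ : EuclideanSpace ℝ (Fin d)) (Y : ℕ → Ω → EuclideanSpace ℝ (Fin d))
    (B : ℕ → Ω → EuclideanSpace ℝ (Fin d) →L[ℝ] EuclideanSpace ℝ (Fin d)) (K : ℝ) (n : ℕ) :
    Set Ω :=
  {ω | ‖Y 0 ω - θ‖ ≤ K} ∩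
    ⋂ k ∈ Finset.range (n + 1), B k ⁻¹' {A | ‖A‖ ≤ K ∧ ∀ u, ‖u‖ ^ 2 ≤ K * inner ℝ u (A u)}

theorem goodSet_succ_subset (K : ℝ) (n : ℕ) : goodSet θ Y B K (n + 1) ⊆ goodSet θ Y B K n :=
  Set.inter_subset_inter_right _
    (Set.biInter_subset_biInter_left fun k hk => by simp at hk ⊢; omega)

theorem of_mem_goodSet {K : ℝ} {n : ℕ} {ω : Ω} (h : ω ∈ goodSet θ Y B K n) :
    ‖B n ω‖ ≤ K ∧ ∀ u, ‖u‖ ^ 2 ≤ K * inner ℝ u (B n ω u) :=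
  Set.mem_iInter₂.1 h.2 n (by simp)

theorem measurableSet_goodSet (M : PreconditionedSGD μ P D G θ X ℱ a Y B L C C') (K : ℝ) (n : ℕ) :
    MeasurableSet[ℱ n] (goodSet θ Y B K n) := by
  refine MeasurableSet.inter ?_ (Finset.measurableSet_biInter _ fun k hk => ?_)
  · have hcl : IsClosed {y : EuclideanSpace ℝ (Fin d) | ‖y - θ‖ ≤ K} :=
      isClosed_le (by fun_prop) continuous_const
    exact (ℱ.mono (Nat.zero_le n)) _ (M.measurable_Y 0 hcl.measurableSet)
  · refine (ℱ.mono (Nat.lt_succ_iff.1 (Finset.mem_range.1 hk))) _ (M.measurable_B k ?_)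
    refine IsClosed.measurableSet ?_
    have : {A : EuclideanSpace ℝ (Fin d) →L[ℝ] EuclideanSpace ℝ (Fin d) |
        ‖A‖ ≤ K ∧ ∀ u, ‖u‖ ^ 2 ≤ K * inner ℝ u (A u)} =
        {A | ‖A‖ ≤ K} ∩ ⋂ u, {A | ‖u‖ ^ 2 ≤ K * inner ℝ u (A u)} := by
      ext A; simp
    rw [this]
    refine (isClosed_le continuous_norm continuous_const).inter (isClosed_iInter fun u => ?_)
    refine isClosed_le continuous_const (continuous_const.mul (continuous_const.inner ?_))
    fun_prop

end PreconditionedSGD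

namespace PreconditionedSGD

variable {d : ℕ} {Ω 𝒳 : Type*} {mΩ : MeasurableSpace Ω} [MeasurableSpace 𝒳]
  {μ : Measure Ω} {P : Measure 𝒳}
  {D : 𝒳 → EuclideanSpace ℝ (Fin d) → EuclideanSpace ℝ (Fin d)}
  {G : EuclideanSpace ℝ (Fin d) → ℝ} {θ : EuclideanSpace ℝ (Fin d)} {X : ℕ → Ω → 𝒳}
  {ℱ : Filtration ℕ mΩ} {a : ℕ → ℝ} {Y : ℕ → Ω → EuclideanSpace ℝ (Fin d)}
  {B : ℕ → Ω → EuclideanSpace ℝ (Fin d) →L[ℝ] EuclideanSpace ℝ (Fin d)} {L C C' : ℝ}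

/-- The excess risk, increased by `1` and set to `0` once the preconditioners have left the range
controlled by `K`. The `1` turns the affine bound on the second moments into a linear one. -/
noncomputable def localizedExcess (G : EuclideanSpace ℝ (Fin d) → ℝ)
    (θ : EuclideanSpace ℝ (Fin d)) (Y : ℕ → Ω → EuclideanSpace ℝ (Fin d))
    (B : ℕ → Ω → EuclideanSpace ℝ (Fin d) →L[ℝ] EuclideanSpace ℝ (Fin d)) (K : ℝ) (n : ℕ)
    (ω : Ω) : ℝ :=
  (goodSet θ Y B K n).indicator 1 ω * (G (Y n ω) - G θ + 1)

/-- The bound on the excess risk after one step of length `t` with sample `p.1`, from the point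
`p.2.1` with preconditioner `p.2.2.1`, weighted by `p.2.2.2`. -/
noncomputable def stepBound (D : 𝒳 → EuclideanSpace ℝ (Fin d) → EuclideanSpace ℝ (Fin d))
    (G : EuclideanSpace ℝ (Fin d) → ℝ) (θ : EuclideanSpace ℝ (Fin d)) (L t : ℝ)
    (p : 𝒳 × EuclideanSpace ℝ (Fin d) ×
      (EuclideanSpace ℝ (Fin d) →L[ℝ] EuclideanSpace ℝ (Fin d)) × ℝ) : ℝ :=
  p.2.2.2 * (G p.2.1 - G θ + 1 - t * inner ℝ (gradient G p.2.1) (p.2.2.1 (D p.1 p.2.1)) +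
    L * t ^ 2 * ‖p.2.2.1 (D p.1 p.2.1)‖ ^ 2)

theorem measurable_stepBound (M : PreconditionedSGD μ P D G θ X ℱ a Y B L C C') (t : ℝ) :
    Measurable (stepBound D G θ L t) := by
  have h1 : Measurable fun p : 𝒳 × EuclideanSpace ℝ (Fin d) ×
      (EuclideanSpace ℝ (Fin d) →L[ℝ] EuclideanSpace ℝ (Fin d)) × ℝ => p.2.2.1 (D p.1 p.2.1) :=
    measurable_clm_apply (by fun_prop)
      (M.measurable_D.comp (measurable_fst.prodMk (measurable_fst.comp measurable_snd)))
  have h2 := M.gradient_continuous.measurable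
  have h3 := M.differentiable.continuous.measurable
  unfold stepBound
  fun_prop

theorem le_stepBound (M : PreconditionedSGD μ P D G θ X ℱ a Y B L C C') (t : ℝ) (x : 𝒳)
    (y : EuclideanSpace ℝ (Fin d)) (A : EuclideanSpace ℝ (Fin d) →L[ℝ] EuclideanSpace ℝ (Fin d))
    {i : ℝ} (hi : 0 ≤ i) :
    i * (G (y - t • A (D x y)) - G θ + 1) ≤ stepBound D G θ L t (x, y, A, i) := by
  refine mul_le_mul_of_nonneg_left ?_ hi
  have h := le_add_inner_gradient_add_sq M.differentiable M.L_nonneg M.lipschitz y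
    (y - t • A (D x y))
  rw [sub_sub_cancel_left, norm_neg, norm_smul, inner_neg_right, inner_smul_right, mul_pow,
    Real.norm_eq_abs, sq_abs] at h
  simp only
  linarith

theorem integral_stepBound_le [IsProbabilityMeasure P]
    (M : PreconditionedSGD μ P D G θ X ℱ a Y B L C C') {t : ℝ}
    (ht : 0 ≤ t) {K : ℝ} (hK : 0 < K) (y : EuclideanSpace ℝ (Fin d))
    (A : EuclideanSpace ℝ (Fin d) →L[ℝ] EuclideanSpace ℝ (Fin d)) {i : ℝ} (hi : 0 ≤ i)
    (hA : i ≠ 0 → ‖A‖ ≤ K ∧ ∀ u, ‖u‖ ^ 2 ≤ K * inner ℝ u (A u)) :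
    ∫ x, stepBound D G θ L t (x, y, A, i) ∂P ≤
      (1 + L * K ^ 2 * (C + C') * t ^ 2) * (i * (G y - G θ + 1)) -
        t / K * (i * ‖gradient G y‖ ^ 2) := by
  obtain ⟨h1, h2⟩ := M.integral_inner_apply A y (gradient G y)
  obtain ⟨h3, h4⟩ := M.integral_norm_apply_sq_le A y
  have e : ∫ x, stepBound D G θ L t (x, y, A, i) ∂P = i * (G y - G θ + 1 -
      t * inner ℝ (gradient G y) (A (gradient G y)) +
        L * t ^ 2 * ∫ x, ‖A (D x y)‖ ^ 2 ∂P) := by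
    simp only [stepBound]
    have h0 : Integrable (fun x => G y - G θ + 1 - t * inner ℝ (gradient G y) (A (D x y))) P :=
      (integrable_const _).sub (h1.const_mul t)
    rw [integral_const_mul, integral_add h0 (h3.const_mul _),
      integral_sub (integrable_const _) (h1.const_mul t), integral_const_mul,
      integral_const_mul, h2]
    simp
  rw [e]
  rcases eq_or_ne i 0 with rfl | hi0
  · simp
  obtain ⟨hA1, hA2⟩ := hA hi0
  have hV := M.excess_nonneg y
  have h5 : ∫ x, ‖A (D x y)‖ ^ 2 ∂P ≤ K ^ 2 * ((C + C') * (G y - G θ + 1)) := by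
    refine h4.trans (mul_le_mul (pow_le_pow_left₀ (norm_nonneg _) hA1 2) ?_ ?_ (sq_nonneg _))
    · nlinarith [M.C_nonneg, M.C'_nonneg, mul_nonneg M.C_nonneg hV]
    · exact add_nonneg M.C_nonneg (mul_nonneg M.C'_nonneg hV)
  have h6 : ‖gradient G y‖ ^ 2 / K ≤ inner ℝ (gradient G y) (A (gradient G y)) := by
    rw [div_le_iff₀' hK]; exact hA2 _
  have h7 := mul_le_mul_of_nonneg_left h5 (mul_nonneg M.L_nonneg (sq_nonneg t))
  have h8 := mul_le_mul_of_nonneg_left h6 ht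
  have h9 : (1 + L * K ^ 2 * (C + C') * t ^ 2) * (i * (G y - G θ + 1)) -
        t / K * (i * ‖gradient G y‖ ^ 2) = i * (G y - G θ + 1 - t * (‖gradient G y‖ ^ 2 / K) +
          L * t ^ 2 * (K ^ 2 * ((C + C') * (G y - G θ + 1)))) := by ring
  rw [h9]
  exact mul_le_mul_of_nonneg_left (by linarith) hi

theorem localizedExcess_nonneg (M : PreconditionedSGD μ P D G θ X ℱ a Y B L C C') (K : ℝ) (n : ℕ)
    (ω : Ω) : 0 ≤ localizedExcess G θ Y B K n ω :=
  mul_nonneg (Set.indicator_nonneg (fun _ _ => zero_le_one) ω)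
    (by linarith [M.excess_nonneg (Y n ω)])

theorem stronglyMeasurable_indicator_goodSet (M : PreconditionedSGD μ P D G θ X ℱ a Y B L C C')
    (K : ℝ) (n : ℕ) :
    StronglyMeasurable[ℱ n] ((goodSet θ Y B K n).indicator (1 : Ω → ℝ)) :=
  stronglyMeasurable_one.indicator (M.measurableSet_goodSet K n)

theorem stronglyMeasurable_localizedExcess (M : PreconditionedSGD μ P D G θ X ℱ a Y B L C C')
    (K : ℝ) (n : ℕ) : StronglyMeasurable[ℱ n] (localizedExcess G θ Y B K n) := by
  have h3 : Measurable (fun y => G y - G θ + 1) :=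
    (M.differentiable.continuous.measurable.sub_const _).add_const _
  exact (M.stronglyMeasurable_indicator_goodSet K n).mul
    (h3.comp (M.measurable_Y n)).stronglyMeasurable

/-- One step of the localized excess risk, integrated over the new sample. -/
theorem integrable_and_condExp_localizedExcess_le [IsProbabilityMeasure μ] [IsProbabilityMeasure P]
    (M : PreconditionedSGD μ P D G θ X ℱ a Y B L C C') {K : ℝ} (hK : 0 < K) {n : ℕ}
    (hn : Integrable (localizedExcess G θ Y B K n) μ) :
    Integrable (localizedExcess G θ Y B K (n + 1)) μ ∧
      ∀ᵐ ω ∂μ, (μ[localizedExcess G θ Y B K (n + 1)|ℱ n]) ω ≤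
        (1 + L * K ^ 2 * (C + C') * a (n + 1) ^ 2) * localizedExcess G θ Y B K n ω -
          a (n + 1) / K *
            ((goodSet θ Y B K n).indicator 1 ω * ‖gradient G (Y n ω)‖ ^ 2) := by
  set t := a (n + 1) with ht
  have ht0 : 0 ≤ t := (M.slowStep.pos n).le
  set i : Ω → ℝ := (goodSet θ Y B K n).indicator 1 with hi
  have hi0 : ∀ ω, 0 ≤ i ω := fun ω => Set.indicator_nonneg (fun _ _ => zero_le_one) ω
  have hiA : ∀ ω, i ω ≠ 0 → ‖B n ω‖ ≤ K ∧ ∀ u, ‖u‖ ^ 2 ≤ K * inner ℝ u (B n ω u) := fun ω h =>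
    of_mem_goodSet (Set.mem_of_indicator_ne_zero h)
  let Z : Ω → EuclideanSpace ℝ (Fin d) ×
    (EuclideanSpace ℝ (Fin d) →L[ℝ] EuclideanSpace ℝ (Fin d)) × ℝ := fun ω => (Y n ω, B n ω, i ω)
  have hZ : Measurable[ℱ n] Z := (M.measurable_Y n).prodMk ((M.measurable_B n).prodMk
    (M.stronglyMeasurable_indicator_goodSet K n).measurable)
  have hfm := M.measurable_stepBound t
  have hfx : ∀ z, Integrable (fun x => stepBound D G θ L t (x, z)) P := by
    intro z
    obtain ⟨h1, -⟩ := M.integral_inner_apply z.2.1 z.1 (gradient G z.1)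
    obtain ⟨h3, -⟩ := M.integral_norm_apply_sq_le z.2.1 z.1
    have h0 : Integrable (fun x => G z.1 - G θ + 1 -
        t * inner ℝ (gradient G z.1) (z.2.1 (D x z.1))) P :=
      (integrable_const _).sub (h1.const_mul t)
    exact (h0.add (h3.const_mul (L * t ^ 2))).const_mul z.2.2
  have hf0 : ∀ x ω, i ω * (G (Y n ω - t • B n ω (D x (Y n ω))) - G θ + 1) ≤
      stepBound D G θ L t (x, Z ω) := fun x ω => M.le_stepBound t x _ _ (hi0 ω)
  have hfnn : ∀ x ω, 0 ≤ stepBound D G θ L t (x, Z ω) := fun x ω =>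
    le_trans (mul_nonneg (hi0 ω) (by linarith [M.excess_nonneg (Y n ω - t • B n ω (D x (Y n ω)))]))
      (hf0 x ω)
  have hmean := fun ω => M.integral_stepBound_le ht0 hK (Y n ω) (B n ω) (hi0 ω) (hiA ω)
  have hWint : Integrable (fun ω => stepBound D G θ L t (X (n + 1) ω, Z ω)) μ := by
    refine integrable_comp_of_indep (ℱ.le n) (M.measurable_X n) (M.law_X n) (M.indep n) hZ hfm hfx
      (hn.const_mul (1 + L * K ^ 2 * (C + C') * t ^ 2)) (ae_of_all _ fun ω => ?_)
    simp only [Real.norm_eq_abs, abs_of_nonneg (hfnn _ ω)]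
    refine (hmean ω).trans (sub_le_self _ ?_)
    have := hi0 ω
    positivity
  have hcond := condExp_comp_of_indep (ℱ.le n) (M.measurable_X n) (M.law_X n) (M.indep n) hZ hfm
    hWint
  have hle : ∀ᵐ ω ∂μ, localizedExcess G θ Y B K (n + 1) ω ≤
      stepBound D G θ L t (X (n + 1) ω, Z ω) := by
    filter_upwards [M.step] with ω hω
    refine le_trans ?_ (hf0 _ ω)
    rw [localizedExcess, hω n]
    refine mul_le_mul_of_nonneg_right ?_
      (by linarith [M.excess_nonneg (Y n ω - t • B n ω (D (X (n + 1) ω) (Y n ω)))])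
    exact Set.indicator_le_indicator_of_subset (goodSet_succ_subset K n)
      (fun _ => zero_le_one) ω
  have hint : Integrable (localizedExcess G θ Y B K (n + 1)) μ := by
    refine hWint.mono' ((M.stronglyMeasurable_localizedExcess K (n + 1)).mono
      (ℱ.le _)).aestronglyMeasurable ?_
    filter_upwards [hle] with ω hω
    rwa [Real.norm_eq_abs, abs_of_nonneg (M.localizedExcess_nonneg K _ ω)]
  refine ⟨hint, ?_⟩
  filter_upwards [condExp_mono (m := ℱ n) hint hWint hle, hcond] with ω h1 h2
  rw [h2] at h1
  exact h1.trans (hmean ω)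

theorem integrable_localizedExcess [IsProbabilityMeasure μ] [IsProbabilityMeasure P]
    (M : PreconditionedSGD μ P D G θ X ℱ a Y B L C C') {K : ℝ} (hK : 0 < K) (n : ℕ) :
    Integrable (localizedExcess G θ Y B K n) μ := by
  induction n with
  | zero =>
    obtain ⟨b, hb⟩ := (isCompact_closedBall θ K).bddAbove_image
      (M.differentiable.continuous.sub continuous_const (g := fun _ => G θ)).continuousOn
    refine ⟨((M.stronglyMeasurable_localizedExcess K 0).mono (ℱ.le _)).aestronglyMeasurable,
      .of_bounded (C := |b| + 1) (ae_of_all _ fun ω => ?_)⟩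
    rw [Real.norm_eq_abs, abs_of_nonneg (M.localizedExcess_nonneg K _ ω), localizedExcess]
    by_cases h : ω ∈ goodSet θ Y B K 0
    · rw [Set.indicator_of_mem h, Pi.one_apply, one_mul]
      have h1 := hb ⟨Y 0 ω, mem_closedBall_iff_norm.2 h.1, rfl⟩
      rw [Pi.sub_apply] at h1
      linarith [le_abs_self b]
    · rw [Set.indicator_of_notMem h, zero_mul]
      positivity
  | succ n ih => exact (M.integrable_and_condExp_localizedExcess_le hK ih).1

/-- Almost sure convergence on the event that the preconditioners are controlled by `K`: discounted
by `exp (-c ∑ a ^ 2)`, the localized excess risk is a nonnegative supermartingale. -/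
theorem ae_tendsto_of_forall_mem_goodSet [IsProbabilityMeasure μ] [IsProbabilityMeasure P]
    (M : PreconditionedSGD μ P D G θ X ℱ a Y B L C C') (hsq : Summable fun n => a n ^ 2)
    {m r : ℝ} (hm : 0 < m) (hr : 0 < r)
    (hgrow : ∀ ε, 0 < ε → ε ≤ r → ∀ h, ε ≤ ‖h - θ‖ → m * ε * ‖h - θ‖ ≤ G h - G θ)
    {K : ℝ} (hK : 0 < K) :
    ∀ᵐ ω ∂μ, (∀ n, ω ∈ goodSet θ Y B K n) → Tendsto (fun n => Y n ω) atTop (𝓝 θ) := by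
  set c := L * K ^ 2 * (C + C') with hc
  have hc0 : 0 ≤ c := mul_nonneg (mul_nonneg M.L_nonneg (sq_nonneg K))
    (add_nonneg M.C_nonneg M.C'_nonneg)
  have hsq' : Summable fun n => a (n + 1) ^ 2 :=
    (summable_nat_add_iff (f := fun n => a n ^ 2) 1).2 hsq
  set e : ℕ → ℝ := fun n => Real.exp (-(c * ∑ k ∈ Finset.range n, a (k + 1) ^ 2)) with he
  have he0 : ∀ n, 0 < e n := fun n => Real.exp_pos _
  have hesucc : ∀ n, e (n + 1) * (1 + c * a (n + 1) ^ 2) ≤ e n := by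
    intro n
    have h1 : 1 + c * a (n + 1) ^ 2 ≤ Real.exp (c * a (n + 1) ^ 2) := by
      linarith [Real.add_one_le_exp (c * a (n + 1) ^ 2)]
    refine (mul_le_mul_of_nonneg_left h1 (he0 _).le).trans (le_of_eq ?_)
    rw [he]
    simp only
    rw [← Real.exp_add, Finset.sum_range_succ]
    congr 1
    ring
  set einf := Real.exp (-(c * ∑' k, a (k + 1) ^ 2)) with heinf
  have helim : Tendsto e atTop (𝓝 einf) :=
    (Real.continuous_exp.tendsto _).comp ((hsq'.hasSum.tendsto_sum_nat.const_mul c).neg)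
  have hele : ∀ n, einf ≤ e n := fun n => by
    refine Real.exp_le_exp.2 (neg_le_neg (mul_le_mul_of_nonneg_left ?_ hc0))
    exact hsq'.sum_le_tsum _ fun k _ => sq_nonneg _
  let i : ℕ → Ω → ℝ := fun n => (goodSet θ Y B K n).indicator 1
  have hi0 : ∀ n ω, 0 ≤ i n ω := fun n ω => Set.indicator_nonneg (fun _ _ => zero_le_one) ω
  let Q : ℕ → Ω → ℝ := fun n ω => i n ω * ‖gradient G (Y n ω)‖ ^ 2
  have hQm : ∀ n, StronglyMeasurable[ℱ n] (Q n) := fun n => by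
    have h2 : Measurable (fun y => ‖gradient G y‖ ^ 2) :=
      M.gradient_continuous.measurable.norm.pow_const 2
    exact (M.stronglyMeasurable_indicator_goodSet K n).mul
      (h2.comp (M.measurable_Y n)).stronglyMeasurable
  have hQ0 : ∀ n ω, 0 ≤ Q n ω := fun n ω => mul_nonneg (hi0 n ω) (sq_nonneg _)
  have hQi : ∀ n, Integrable (Q n) μ := fun n => by
    refine ((M.integrable_localizedExcess hK n).const_mul (C + C')).mono'
      ((hQm n).mono (ℱ.le n)).aestronglyMeasurable (ae_of_all _ fun ω => ?_)
    rw [Real.norm_eq_abs, abs_of_nonneg (hQ0 n ω), localizedExcess, mul_left_comm]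
    refine mul_le_mul_of_nonneg_left ((M.norm_gradient_sq_le _).trans ?_) (hi0 n ω)
    have hV := M.excess_nonneg (Y n ω)
    nlinarith [M.C_nonneg, M.C'_nonneg, mul_nonneg M.C_nonneg hV]
  have key := ae_tendsto_and_summable_of_condExp_le (μ := μ) (ℱ := ℱ)
    (U := fun n => e n • localizedExcess G θ Y B K n)
    (R := fun n => (e (n + 1) * (a (n + 1) / K)) • Q n)
    (fun n => (M.stronglyMeasurable_localizedExcess K n).const_smul _)
    (fun n => (hQm n).const_smul _)
    (fun n ω => mul_nonneg (he0 n).le (M.localizedExcess_nonneg K n ω))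
    (fun n ω => mul_nonneg (mul_nonneg (he0 _).le (div_nonneg (M.slowStep.pos n).le hK.le))
      (hQ0 n ω))
    (fun n => (M.integrable_localizedExcess hK n).smul _) (fun n => (hQi n).smul _) (fun n => by
      filter_upwards [(M.integrable_and_condExp_localizedExcess_le hK
        (M.integrable_localizedExcess hK n)).2,
        condExp_smul (μ := μ) (e (n + 1)) (localizedExcess G θ Y B K (n + 1)) (ℱ n)] with ω h1 h2
      rw [h2]
      simp only [Pi.smul_apply, Pi.sub_apply, smul_eq_mul]
      have h3 := mul_le_mul_of_nonneg_left h1 (he0 (n + 1)).le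
      have h4 := mul_le_mul_of_nonneg_right (hesucc n) (M.localizedExcess_nonneg K n ω)
      refine h3.trans ?_
      simp only [Q, i]
      nlinarith)
  filter_upwards [key] with ω ⟨⟨l, hl⟩, hsum⟩ hgood
  have hi1 : ∀ n, i n ω = 1 := fun n => Set.indicator_of_mem (hgood n) _
  have hlim : Tendsto (fun n => G (Y n ω)) atTop (𝓝 (l / einf + G θ - 1)) := by
    have h1 := hl.div helim (Real.exp_pos _).ne'
    refine ((h1.add_const (G θ)).sub_const 1).congr fun n => ?_
    have h2 : localizedExcess G θ Y B K n ω = G (Y n ω) - G θ + 1 := by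
      rw [localizedExcess, Set.indicator_of_mem (hgood n), Pi.one_apply, one_mul]
    simp only [Pi.smul_apply, smul_eq_mul, h2, Pi.div_apply]
    rw [mul_div_cancel_left₀ _ (he0 n).ne']
    ring
  refine tendsto_of_summable_sq_gradient M.convexOn M.differentiable hm hr hgrow M.slowStep hlim ?_
  refine Summable.of_nonneg_of_le (fun n => mul_nonneg (M.slowStep.pos n).le (sq_nonneg _))
    (fun n => ?_) (hsum.mul_left (K / einf))
  simp only [Pi.smul_apply, smul_eq_mul, Q, hi1 n, one_mul]
  have hx : 0 ≤ a (n + 1) * ‖gradient G (Y n ω)‖ ^ 2 :=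
    mul_nonneg (M.slowStep.pos n).le (sq_nonneg _)
  have heinf0 : 0 < einf := Real.exp_pos _
  calc a (n + 1) * ‖gradient G (Y n ω)‖ ^ 2
      ≤ e (n + 1) / einf * (a (n + 1) * ‖gradient G (Y n ω)‖ ^ 2) :=
        le_mul_of_one_le_left hx ((one_le_div heinf0).2 (hele _))
    _ = _ := by field_simp

/-- Almost sure consistency, for preconditioners that are almost surely bounded and uniformly
coercive. -/
theorem ae_tendsto [IsProbabilityMeasure μ] [IsProbabilityMeasure P]
    (M : PreconditionedSGD μ P D G θ X ℱ a Y B L C C') (hsq : Summable fun n => a n ^ 2)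
    {m r : ℝ} (hm : 0 < m) (hr : 0 < r)
    (hgrow : ∀ ε, 0 < ε → ε ≤ r → ∀ h, ε ≤ ‖h - θ‖ → m * ε * ‖h - θ‖ ≤ G h - G θ)
    (hB : ∀ᵐ ω ∂μ, ∃ K : ℝ, ∀ n, ‖B n ω‖ ≤ K ∧ ∀ u, ‖u‖ ^ 2 ≤ K * inner ℝ u (B n ω u)) :
    ∀ᵐ ω ∂μ, Tendsto (fun n => Y n ω) atTop (𝓝 θ) := by
  have h1 : ∀ᵐ ω ∂μ, ∀ N : ℕ, (∀ n, ω ∈ goodSet θ Y B ((N : ℝ) + 1) n) →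
      Tendsto (fun n => Y n ω) atTop (𝓝 θ) := ae_all_iff.2 fun N =>
    M.ae_tendsto_of_forall_mem_goodSet hsq hm hr hgrow (by positivity)
  filter_upwards [h1, hB] with ω h1 ⟨K, hK⟩
  obtain ⟨N, hN⟩ := exists_nat_ge (max K ‖Y 0 ω - θ‖)
  refine h1 N fun n => ⟨?_, Set.mem_iInter₂.2 fun k _ => ⟨?_, fun u => ?_⟩⟩
  · exact ((le_max_right _ _).trans hN).trans (by linarith)
  · exact (hK k).1.trans (((le_max_left _ _).trans hN).trans (by linarith))
  · have hK' : K ≤ (N : ℝ) + 1 := ((le_max_left _ _).trans hN).trans (by linarith)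
    have hK0 : 0 ≤ K := (norm_nonneg _).trans (hK k).1
    rcases le_or_gt 0 (inner ℝ u (B k ω u)) with h | h
    · exact ((hK k).2 u).trans (mul_le_mul_of_nonneg_right hK' h)
    · have h2 := (hK k).2 u
      have h3 : ‖u‖ ^ 2 ≤ 0 := h2.trans (mul_nonpos_of_nonneg_of_nonpos hK0 h.le)
      have h4 : u = 0 := by
        rw [← norm_eq_zero]
        exact pow_eq_zero_iff two_ne_zero |>.1 (le_antisymm h3 (sq_nonneg _))
      simp [h4]

end PreconditionedSGD

/-! ### Rate of convergence -/

theorem add_rpow_le_two_rpow_mul {x y q : ℝ} (hx : 0 ≤ x) (hy : 0 ≤ y) (hq : 0 ≤ q) :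
    (x + y) ^ q ≤ 2 ^ q * (x ^ q + y ^ q) := by
  wlog h : y ≤ x generalizing x y
  · rw [add_comm x y, add_comm (x ^ q)]
    exact this hy hx (le_of_not_ge h)
  calc (x + y) ^ q ≤ (2 * x) ^ q := Real.rpow_le_rpow (add_nonneg hx hy) (by linarith) hq
    _ = 2 ^ q * x ^ q := Real.mul_rpow zero_le_two hx
    _ ≤ _ := by
        gcongr
        have := Real.rpow_nonneg hy q
        linarith

theorem norm_le_sum_abs {d : ℕ} (x : EuclideanSpace ℝ (Fin d)) : ‖x‖ ≤ ∑ j, |x j| := by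
  conv_lhs => rw [← (EuclideanSpace.basisFun (Fin d) ℝ).sum_repr x]
  refine (norm_sum_le _ _).trans (Finset.sum_le_sum fun j _ => ?_)
  simp [norm_smul]

theorem abs_apply_le_norm {d : ℕ} (x : EuclideanSpace ℝ (Fin d)) (j : Fin d) : |x j| ≤ ‖x‖ :=
  PiLp.norm_apply_le x j

namespace PreconditionedSGD

variable {d : ℕ} {Ω 𝒳 : Type*} {mΩ : MeasurableSpace Ω}
  {D : 𝒳 → EuclideanSpace ℝ (Fin d) → EuclideanSpace ℝ (Fin d)}
  {G : EuclideanSpace ℝ (Fin d) → ℝ} {θ : EuclideanSpace ℝ (Fin d)}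

/-- A coordinate of the noise as a function of the new sample `p.1` and of the current iterate,
preconditioner and indicator. -/
noncomputable def noiseCoord (D : 𝒳 → EuclideanSpace ℝ (Fin d) → EuclideanSpace ℝ (Fin d))
    (G : EuclideanSpace ℝ (Fin d) → ℝ) (j : Fin d)
    (p : 𝒳 × EuclideanSpace ℝ (Fin d) ×
      (EuclideanSpace ℝ (Fin d) →L[ℝ] EuclideanSpace ℝ (Fin d)) × ℝ) : ℝ :=
  p.2.2.2 * p.2.2.1 (D p.1 p.2.1 - gradient G p.2.1) j

theorem abs_noiseCoord_rpow_le (j : Fin d) {q : ℝ} (hq : 0 ≤ q) (x : 𝒳)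
    (y : EuclideanSpace ℝ (Fin d)) (A : EuclideanSpace ℝ (Fin d) →L[ℝ] EuclideanSpace ℝ (Fin d))
    (i : ℝ) : |noiseCoord D G j (x, y, A, i)| ^ q ≤
      (|i| * ‖A‖) ^ q * (2 ^ q * (‖D x y‖ ^ q + ‖gradient G y‖ ^ q)) := by
  have h1 : |noiseCoord D G j (x, y, A, i)| ≤ (|i| * ‖A‖) * (‖D x y‖ + ‖gradient G y‖) := by
    rw [noiseCoord, abs_mul, mul_assoc]
    refine mul_le_mul_of_nonneg_left ?_ (abs_nonneg i)
    exact (abs_apply_le_norm _ j).trans ((A.le_opNorm _).trans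
      (mul_le_mul_of_nonneg_left (norm_sub_le _ _) (norm_nonneg A)))
  refine (Real.rpow_le_rpow (abs_nonneg _) h1 hq).trans ?_
  rw [Real.mul_rpow (by positivity) (by positivity)]
  exact mul_le_mul_of_nonneg_left (add_rpow_le_two_rpow_mul (norm_nonneg _) (norm_nonneg _) hq)
    (by positivity)

variable [MeasurableSpace 𝒳] {μ : Measure Ω} {P : Measure 𝒳} {X : ℕ → Ω → 𝒳} {ℱ : Filtration ℕ mΩ}
  {a : ℕ → ℝ} {Y : ℕ → Ω → EuclideanSpace ℝ (Fin d)}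
  {B : ℕ → Ω → EuclideanSpace ℝ (Fin d) →L[ℝ] EuclideanSpace ℝ (Fin d)} {L C C' : ℝ}

/-- The event that at time `n` the iterate is in the unit ball around `θ` and the norm of the
preconditioner is at most `K`. -/
def nearSet (θ : EuclideanSpace ℝ (Fin d)) (Y : ℕ → Ω → EuclideanSpace ℝ (Fin d))
    (B : ℕ → Ω → EuclideanSpace ℝ (Fin d) →L[ℝ] EuclideanSpace ℝ (Fin d)) (K : ℝ) (n : ℕ) :
    Set Ω :=
  Y n ⁻¹' {y | ‖y - θ‖ ≤ 1} ∩ B n ⁻¹' {A | ‖A‖ ≤ K}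

theorem measurableSet_nearSet (M : PreconditionedSGD μ P D G θ X ℱ a Y B L C C') (K : ℝ) (n : ℕ) :
    MeasurableSet[ℱ n] (nearSet θ Y B K n) :=
  (M.measurable_Y n (isClosed_le (by fun_prop) continuous_const).measurableSet).inter
    (M.measurable_B n (isClosed_le continuous_norm continuous_const).measurableSet)

/-- The noise of the step from time `n` to `n + 1`, on the event `nearSet`. It is expressed through
the iterates, not through the sample `X (n + 1)`, which need not be measurable at time `n + 1`. -/
noncomputable def localNoise (G : EuclideanSpace ℝ (Fin d) → ℝ) (θ : EuclideanSpace ℝ (Fin d))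
    (a : ℕ → ℝ) (Y : ℕ → Ω → EuclideanSpace ℝ (Fin d))
    (B : ℕ → Ω → EuclideanSpace ℝ (Fin d) →L[ℝ] EuclideanSpace ℝ (Fin d)) (K : ℝ) (n : ℕ)
    (ω : Ω) : EuclideanSpace ℝ (Fin d) :=
  (nearSet θ Y B K n).indicator (1 : Ω → ℝ) ω •
    ((a (n + 1))⁻¹ • (Y n ω - Y (n + 1) ω) - B n ω (gradient G (Y n ω)))

theorem measurable_localNoise (M : PreconditionedSGD μ P D G θ X ℱ a Y B L C C') (K : ℝ) (n : ℕ) :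
    Measurable[ℱ (n + 1)] (localNoise G θ a Y B K n) := by
  have hn := ℱ.mono n.le_succ
  let Z : Ω → ℝ × EuclideanSpace ℝ (Fin d) × EuclideanSpace ℝ (Fin d) ×
      (EuclideanSpace ℝ (Fin d) →L[ℝ] EuclideanSpace ℝ (Fin d)) :=
    fun ω => ((nearSet θ Y B K n).indicator 1 ω, Y n ω, Y (n + 1) ω, B n ω)
  have hZ : Measurable[ℱ (n + 1)] Z :=
    (stronglyMeasurable_one.indicator (hn _ (M.measurableSet_nearSet K n))).measurable.prodMk
      (((M.measurable_Y n).mono hn le_rfl).prodMk ((M.measurable_Y (n + 1)).prodMk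
        ((M.measurable_B n).mono hn le_rfl)))
  let Φ : ℝ × EuclideanSpace ℝ (Fin d) × EuclideanSpace ℝ (Fin d) ×
      (EuclideanSpace ℝ (Fin d) →L[ℝ] EuclideanSpace ℝ (Fin d)) → EuclideanSpace ℝ (Fin d) :=
    fun p => p.1 • ((a (n + 1))⁻¹ • (p.2.1 - p.2.2.1) - p.2.2.2 (gradient G p.2.1))
  have hΦ : Measurable Φ := by
    have h1 : Measurable fun p : ℝ × EuclideanSpace ℝ (Fin d) × EuclideanSpace ℝ (Fin d) ×
        (EuclideanSpace ℝ (Fin d) →L[ℝ] EuclideanSpace ℝ (Fin d)) =>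
          p.2.2.2 (gradient G p.2.1) :=
      measurable_clm_apply (by fun_prop)
        (M.gradient_continuous.measurable.comp (measurable_fst.comp measurable_snd))
    fun_prop
  exact hΦ.comp hZ

theorem measurable_noiseCoord (M : PreconditionedSGD μ P D G θ X ℱ a Y B L C C') (j : Fin d) :
    Measurable (noiseCoord D G j) := by
  have h1 : Measurable fun p : 𝒳 × EuclideanSpace ℝ (Fin d) ×
      (EuclideanSpace ℝ (Fin d) →L[ℝ] EuclideanSpace ℝ (Fin d)) × ℝ =>
        p.2.2.1 (D p.1 p.2.1 - gradient G p.2.1) :=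
    measurable_clm_apply (by fun_prop)
      ((M.measurable_D.comp (measurable_fst.prodMk (measurable_fst.comp measurable_snd))).sub
        (M.gradient_continuous.measurable.comp (measurable_fst.comp measurable_snd)))
  have h2 : Continuous fun x : EuclideanSpace ℝ (Fin d) => x j := by fun_prop
  exact Measurable.mul (by fun_prop) (h2.measurable.comp h1)

theorem localNoise_apply_ae_eq (M : PreconditionedSGD μ P D G θ X ℱ a Y B L C C') (K : ℝ) (n : ℕ)
    (j : Fin d) : (fun ω => localNoise G θ a Y B K n ω j) =ᵐ[μ] fun ω =>
      noiseCoord D G j (X (n + 1) ω, Y n ω, B n ω, (nearSet θ Y B K n).indicator 1 ω) := by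
  filter_upwards [M.step] with ω hω
  simp only [localNoise, noiseCoord]
  rw [hω n, sub_sub_cancel, smul_smul, inv_mul_cancel₀ (M.slowStep.pos n).ne', one_smul, map_sub]
  simp

theorem integrable_noiseCoord_rpow [IsProbabilityMeasure P]
    (M : PreconditionedSGD μ P D G θ X ℱ a Y B L C C') {q : ℝ}
    (hq : 0 ≤ q) (hDq : ∀ h, Integrable (fun x => ‖D x h‖ ^ q) P) (j : Fin d)
    (y : EuclideanSpace ℝ (Fin d)) (A : EuclideanSpace ℝ (Fin d) →L[ℝ] EuclideanSpace ℝ (Fin d))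
    (i : ℝ) : Integrable (fun x => |noiseCoord D G j (x, y, A, i)| ^ q) P := by
  refine ((((hDq y).add (integrable_const (‖gradient G y‖ ^ q))).const_mul (2 ^ q)).const_mul
    ((|i| * ‖A‖) ^ q)).mono' ?_ (ae_of_all _ fun x => ?_)
  · have h1 := (M.measurable_noiseCoord j).comp (measurable_prodMk_right (y := (y, A, i)))
    exact ((measurable_norm.comp h1).pow_const q).aestronglyMeasurable
  · rw [Real.norm_eq_abs, abs_of_nonneg (Real.rpow_nonneg (abs_nonneg _) _)]
    exact abs_noiseCoord_rpow_le j hq x y A i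

/-- Near `θ`, the conditional moments of order `q` of the noise are bounded. -/
theorem integral_noiseCoord_rpow_le [IsProbabilityMeasure P]
    (M : PreconditionedSGD μ P D G θ X ℱ a Y B L C C') {q Cq : ℝ}
    (hq : 0 < q) (hDq : ∀ h, Integrable (fun x => ‖D x h‖ ^ q) P)
    (hCq : ∀ h, ∫ x, ‖D x h‖ ^ q ∂P ≤ Cq * (1 + ‖h - θ‖ ^ q)) (hCq0 : 0 ≤ Cq) (j : Fin d) {K : ℝ}
    (hK : 0 ≤ K) (n : ℕ) (ω : Ω) :
    ∫ x, |noiseCoord D G j (x, Y n ω, B n ω, (nearSet θ Y B K n).indicator 1 ω)| ^ q ∂P ≤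
      K ^ q * (2 ^ q * (Cq * 2 + L ^ q)) := by
  have hL := M.L_nonneg
  by_cases h : ω ∈ nearSet θ Y B K n
  · obtain ⟨h1, h2⟩ : ‖Y n ω - θ‖ ≤ 1 ∧ ‖B n ω‖ ≤ K := ⟨h.1, h.2⟩
    rw [Set.indicator_of_mem h, Pi.one_apply]
    have h3 : ‖gradient G (Y n ω)‖ ≤ L := by
      have := M.lipschitz (Y n ω) θ
      rw [M.gradient_eq_zero, sub_zero] at this
      exact this.trans (mul_le_of_le_one_right hL h1)
    have h4 : ∫ x, ‖D x (Y n ω)‖ ^ q ∂P ≤ Cq * 2 := by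
      refine (hCq _).trans (mul_le_mul_of_nonneg_left ?_ hCq0)
      linarith [Real.rpow_le_one (norm_nonneg _) h1 hq.le]
    have h6 : Integrable (fun x => ‖D x (Y n ω)‖ ^ q + ‖gradient G (Y n ω)‖ ^ q) P :=
      (hDq _).add (integrable_const _)
    calc _ ≤ ∫ x, (|1| * ‖B n ω‖) ^ q *
          (2 ^ q * (‖D x (Y n ω)‖ ^ q + ‖gradient G (Y n ω)‖ ^ q)) ∂P :=
          integral_mono (M.integrable_noiseCoord_rpow hq.le hDq j _ _ _)
            ((h6.const_mul _).const_mul _) fun x => abs_noiseCoord_rpow_le j hq.le x _ _ _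
      _ = (|1| * ‖B n ω‖) ^ q *
          (2 ^ q * (∫ x, ‖D x (Y n ω)‖ ^ q ∂P + ‖gradient G (Y n ω)‖ ^ q)) := by
          rw [integral_const_mul, integral_const_mul, integral_add (hDq _) (integrable_const _)]
          simp
      _ ≤ _ := by
          rw [abs_one, one_mul]
          have h5 : 0 ≤ ∫ x, ‖D x (Y n ω)‖ ^ q ∂P :=
            integral_nonneg fun _ => Real.rpow_nonneg (norm_nonneg _) _
          gcongr
  · rw [Set.indicator_of_notMem h]
    simp only [noiseCoord, zero_mul, abs_zero, Real.zero_rpow hq.ne', integral_zero]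
    positivity

theorem integral_noiseCoord_eq_zero [IsProbabilityMeasure P]
    (M : PreconditionedSGD μ P D G θ X ℱ a Y B L C C') (j : Fin d)
    (y : EuclideanSpace ℝ (Fin d)) (A : EuclideanSpace ℝ (Fin d) →L[ℝ] EuclideanSpace ℝ (Fin d))
    (i : ℝ) : ∫ x, noiseCoord D G j (x, y, A, i) ∂P = 0 := by
  have e : ∀ w : EuclideanSpace ℝ (Fin d), w j = inner ℝ (EuclideanSpace.single j 1) w := by
    intro w; rw [EuclideanSpace.inner_single_left]; simp
  obtain ⟨h1, h2⟩ := M.integral_inner_apply A y (EuclideanSpace.single j 1)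
  simp only [noiseCoord, map_sub, e, inner_sub_right]
  rw [integral_const_mul, integral_sub h1 (integrable_const _), h2]
  simp

/-- The averaged noise is of the order of `rate a`, in every coordinate. -/
theorem ae_avgFrom_localNoise_le [IsProbabilityMeasure μ] [IsProbabilityMeasure P]
    (M : PreconditionedSGD μ P D G θ X ℱ a Y B L C C') {q Cq : ℝ} (hq : 2 ≤ q)
    (hsum : Summable fun n => rate a n ^ q)
    (hDq : ∀ h, Integrable (fun x => ‖D x h‖ ^ q) P)
    (hCq : ∀ h, ∫ x, ‖D x h‖ ^ q ∂P ≤ Cq * (1 + ‖h - θ‖ ^ q)) (hCq0 : 0 ≤ Cq) (j : Fin d) {K : ℝ}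
    (hK : 0 ≤ K) :
    ∀ᵐ ω ∂μ, ∃ b, 0 ≤ b ∧ ∀ᶠ n in atTop,
      |avgFrom a 0 (fun n ω => localNoise G θ a Y B K n ω j) n ω| ≤ b * rate a n := by
  have hq0 : 0 < q := by linarith
  have hL := M.L_nonneg
  let Z : ℕ → Ω → EuclideanSpace ℝ (Fin d) ×
    (EuclideanSpace ℝ (Fin d) →L[ℝ] EuclideanSpace ℝ (Fin d)) × ℝ :=
    fun n ω => (Y n ω, B n ω, (nearSet θ Y B K n).indicator 1 ω)
  have hZ : ∀ n, Measurable[ℱ n] (Z n) := fun n =>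
    (M.measurable_Y n).prodMk ((M.measurable_B n).prodMk
      (stronglyMeasurable_one.indicator (M.measurableSet_nearSet K n)).measurable)
  have hae := fun n => M.localNoise_apply_ae_eq K n j
  have hcoord : Measurable fun x : EuclideanSpace ℝ (Fin d) => x j :=
    Continuous.measurable (by fun_prop)
  have hmeas : ∀ n, Measurable[ℱ (n + 1)] fun ω => localNoise G θ a Y B K n ω j := fun n =>
    hcoord.comp (M.measurable_localNoise K n)
  have hfm := M.measurable_noiseCoord j
  have hfqm : Measurable fun p => |noiseCoord D G j p| ^ q :=
    (measurable_norm.comp hfm).pow_const q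
  have hpow : ∀ n, (fun ω => |localNoise G θ a Y B K n ω j| ^ q) =ᵐ[μ] fun ω =>
      |noiseCoord D G j (X (n + 1) ω, Z n ω)| ^ q := fun n => by
    filter_upwards [hae n] with ω hω
    rw [hω]
  have hintq' : ∀ n, Integrable (fun ω => |noiseCoord D G j (X (n + 1) ω, Z n ω)| ^ q) μ := by
    intro n
    refine integrable_comp_of_indep (f := fun p => |noiseCoord D G j p| ^ q) (ℱ.le n)
      (M.measurable_X n) (M.law_X n) (M.indep n) (hZ n) hfqm
      (fun z => M.integrable_noiseCoord_rpow hq0.le hDq j _ _ _)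
      (integrable_const (K ^ q * (2 ^ q * (Cq * 2 + L ^ q)))) (ae_of_all _ fun ω => ?_)
    simp only [Real.norm_eq_abs, abs_of_nonneg (Real.rpow_nonneg (abs_nonneg _) q)]
    exact M.integral_noiseCoord_rpow_le hq0 hDq hCq hCq0 j hK n ω
  have hintq : ∀ n, Integrable (fun ω => |localNoise G θ a Y B K n ω j| ^ q) μ := fun n =>
    (hintq' n).congr (hpow n).symm
  have hint : ∀ n, Integrable (fun ω => localNoise G θ a Y B K n ω j) μ := by
    intro n
    refine ((integrable_const (2 : ℝ)).add (hintq n)).mono'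
      ((hmeas n).mono (ℱ.le _) le_rfl).aestronglyMeasurable (ae_of_all _ fun ω => ?_)
    have h := sq_le_one_add_rpow (abs_nonneg (localNoise G θ a Y B K n ω j)) hq
    simp only [Real.norm_eq_abs, Pi.add_apply]
    nlinarith [sq_nonneg (|localNoise G θ a Y B K n ω j| - 1)]
  refine ae_isBigO_rate_of_average (K := K ^ q * (2 ^ q * (Cq * 2 + L ^ q)))
    (ζ := fun n ω => localNoise G θ a Y B K n ω j) M.slowStep hq hsum hmeas hint hintq
    (fun n => ?_) (by positivity) (fun n => ?_) (fun n ω => avgFrom_succ a (Nat.zero_le n) _ ω)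
  · have h1 := condExp_comp_of_indep (ℱ.le n) (M.measurable_X n) (M.law_X n) (M.indep n) (hZ n) hfm
      ((hint n).congr (hae n))
    filter_upwards [condExp_congr_ae (m := ℱ n) (hae n), h1] with ω h2 h3
    rw [h2]
    exact h3.trans (M.integral_noiseCoord_eq_zero j _ _ _)
  · have h1 := condExp_comp_of_indep (f := fun p => |noiseCoord D G j p| ^ q) (ℱ.le n)
      (M.measurable_X n) (M.law_X n) (M.indep n) (hZ n) hfqm (hintq' n)
    filter_upwards [condExp_congr_ae (m := ℱ n) (hpow n), h1] with ω h2 h3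
    rw [h2, h3]
    exact M.integral_noiseCoord_rpow_le hq0 hDq hCq hCq0 j hK n ω

/-- Linearization at `θ`: if the preconditioners tend to the inverse of the Hessian, the
preconditioned gradient is `y - θ` up to a small relative error. -/
theorem eventually_norm_sub_apply_gradient_le {A A' : EuclideanSpace ℝ (Fin d) →L[ℝ]
      EuclideanSpace ℝ (Fin d)} (h0 : gradient G θ = 0) (hA : HasFDerivAt (gradient G) A θ)
    (hinv : ∀ u, A' (A u) = u) {y : ℕ → EuclideanSpace ℝ (Fin d)}
    (hy : Tendsto y atTop (𝓝 θ))
    {T : ℕ → EuclideanSpace ℝ (Fin d) →L[ℝ] EuclideanSpace ℝ (Fin d)}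
    (hT : Tendsto T atTop (𝓝 A')) :
    ∀ᶠ n in atTop, ‖(y n - θ) - T n (gradient G (y n))‖ ≤ 1 / 2 * ‖y n - θ‖ := by
  have hlo := hy.eventually (hA.isLittleO.def (c := 1 / (4 * (‖A'‖ + 1))) (by positivity))
  have hT1 : ∀ᶠ n in atTop, ‖T n‖ ≤ ‖A'‖ + 1 := hT.norm.eventually_le_const (by linarith)
  have hT2 : ∀ᶠ n in atTop, ‖T n - A'‖ ≤ 1 / (4 * (‖A‖ + 1)) :=
    (tendsto_iff_norm_sub_tendsto_zero.1 hT).eventually_le_const (by positivity)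
  filter_upwards [hlo, hT1, hT2] with n h1 h2 h3
  rw [h0, sub_zero] at h1
  generalize y n - θ = u at h1 ⊢
  have e : u - T n (gradient G (y n)) = -((T n - A') (A u)) - T n (gradient G (y n) - A u) := by
    rw [sub_apply, hinv, map_sub]; abel
  rw [e]
  have hA0 := norm_nonneg A
  have hA'0 := norm_nonneg A'
  have h4 : ‖(T n - A') (A u)‖ ≤ 1 / 4 * ‖u‖ := by
    calc ‖(T n - A') (A u)‖ ≤ 1 / (4 * (‖A‖ + 1)) * (‖A‖ * ‖u‖) :=
          ((T n - A').le_opNorm _).trans (by gcongr; exact A.le_opNorm u)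
      _ = 1 / 4 * (‖A‖ / (‖A‖ + 1)) * ‖u‖ := by field_simp
      _ ≤ 1 / 4 * 1 * ‖u‖ := by
          gcongr
          rw [div_le_one (by positivity)]; linarith
      _ = _ := by ring
  have h5 : ‖T n (gradient G (y n) - A u)‖ ≤ 1 / 4 * ‖u‖ := by
    calc ‖T n (gradient G (y n) - A u)‖ ≤ (‖A'‖ + 1) * (1 / (4 * (‖A'‖ + 1)) * ‖u‖) :=
          ((T n).le_opNorm _).trans (by gcongr)
      _ = 1 / 4 * ‖u‖ := by field_simp
  calc _ ≤ ‖(T n - A') (A u)‖ + ‖T n (gradient G (y n) - A u)‖ := by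
        refine (norm_sub_le _ _).trans ?_
        rw [norm_neg]
    _ ≤ _ := by linarith

/-- The rate of convergence of consistent iterates whose preconditioners tend to the inverse of the
Hessian: the averaged noise has the order `rate a`, and the sum of the error and of the averaged
noise is contracted. -/
theorem ae_norm_sub_le_rate [IsProbabilityMeasure μ] [IsProbabilityMeasure P]
    (M : PreconditionedSGD μ P D G θ X ℱ a Y B L C C') {q Cq : ℝ} (hq : 2 ≤ q)
    (hsum : Summable fun n => rate a n ^ q)
    (hDq : ∀ h, Integrable (fun x => ‖D x h‖ ^ q) P)
    (hCq : ∀ h, ∫ x, ‖D x h‖ ^ q ∂P ≤ Cq * (1 + ‖h - θ‖ ^ q)) (hCq0 : 0 ≤ Cq)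
    {A A' : EuclideanSpace ℝ (Fin d) →L[ℝ] EuclideanSpace ℝ (Fin d)}
    (hA : HasFDerivAt (gradient G) A θ) (hinv : ∀ u, A' (A u) = u)
    (hY : ∀ᵐ ω ∂μ, Tendsto (fun n => Y n ω) atTop (𝓝 θ))
    (hB : ∀ᵐ ω ∂μ, Tendsto (fun n => B n ω) atTop (𝓝 A')) :
    ∀ᵐ ω ∂μ, ∃ b, ∀ᶠ n in atTop, ‖Y n ω - θ‖ ≤ b * rate a n := by
  have hK0 : 0 ≤ ‖A'‖ + 1 := by positivity
  set K := ‖A'‖ + 1 with hK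
  have hnoise : ∀ᵐ ω ∂μ, ∀ j, ∃ b, 0 ≤ b ∧ ∀ᶠ n in atTop,
      |avgFrom a 0 (fun n ω => localNoise G θ a Y B K n ω j) n ω| ≤ b * rate a n :=
    ae_all_iff.2 fun j => M.ae_avgFrom_localNoise_le hq hsum hDq hCq hCq0 j hK0
  filter_upwards [hnoise, hY, hB] with ω h1 hy hT
  choose b hb0 hb using h1
  let w : ℕ → EuclideanSpace ℝ (Fin d) := fun n =>
    WithLp.toLp 2 fun j => avgFrom a 0 (fun n ω => localNoise G θ a Y B K n ω j) n ω
  have hwsucc : ∀ n, w (n + 1) =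
      (1 - a (n + 1)) • w n + a (n + 1) • localNoise G θ a Y B K n ω := by
    intro n
    ext j
    simp only [w, PiLp.add_apply, PiLp.smul_apply, smul_eq_mul]
    exact avgFrom_succ a (Nat.zero_le n) _ ω
  have hw : ∀ᶠ n in atTop, ‖w n‖ ≤ (∑ j, b j) * rate a n := by
    filter_upwards [eventually_all.2 hb] with n hn
    rw [Finset.sum_mul]
    exact (norm_le_sum_abs _).trans (Finset.sum_le_sum fun j _ => hn j)
  have hbsum : 0 ≤ ∑ j, b j := Finset.sum_nonneg fun j _ => hb0 j
  have hnear : ∀ᶠ n in atTop, ω ∈ nearSet θ Y B K n := by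
    have h2 : ∀ᶠ n in atTop, ‖Y n ω - θ‖ ≤ 1 :=
      (tendsto_iff_norm_sub_tendsto_zero.1 hy).eventually_le_const one_pos
    have h3 : ∀ᶠ n in atTop, ‖B n ω‖ ≤ K := hT.norm.eventually_le_const (by linarith)
    filter_upwards [h2, h3] with n h2 h3 using ⟨h2, h3⟩
  obtain ⟨b', -, hb'⟩ := M.slowStep.isBigO_rate_of_recursion
    (x := fun n => ‖(Y n ω - θ) + w n‖) (K := ∑ j, b j) (by
      filter_upwards [hw, hnear, M.slowStep.eventually_rate_le_two_mul,
        (tendsto_add_atTop_nat 1).eventually M.slowStep.eventually_le_one,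
        eventually_norm_sub_apply_gradient_le M.gradient_eq_zero hA hinv hy hT]
        with n h2 h3 h4 h5 h6
      have hp := M.slowStep.pos n
      have e : (Y (n + 1) ω - θ) + w (n + 1) = (1 - a (n + 1)) • ((Y n ω - θ) + w n) +
          a (n + 1) • ((Y n ω - θ) - B n ω (gradient G (Y n ω))) := by
        rw [hwsucc, localNoise, Set.indicator_of_mem h3, Pi.one_apply, one_smul,
          smul_sub (a (n + 1)) ((a (n + 1))⁻¹ • _), smul_smul, mul_inv_cancel₀ hp.ne', one_smul]
        module
      rw [e]
      refine (norm_add_le _ _).trans ?_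
      rw [norm_smul, norm_smul, Real.norm_eq_abs, Real.norm_eq_abs, abs_of_pos hp,
        abs_of_nonneg (by linarith)]
      have h7 : ‖Y n ω - θ‖ ≤ ‖(Y n ω - θ) + w n‖ + ‖w n‖ := by
        have := norm_sub_le ((Y n ω - θ) + w n) (w n)
        rwa [add_sub_cancel_right] at this
      have h8 : ‖w n‖ ≤ (∑ j, b j) * (2 * rate a (n + 1)) :=
        h2.trans (mul_le_mul_of_nonneg_left h4 hbsum)
      have h9 := mul_le_mul_of_nonneg_left (h6.trans (mul_le_mul_of_nonneg_left
        (h7.trans (add_le_add_right h8 _)) (by norm_num))) hp.le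
      linarith)
  refine ⟨b' + ∑ j, b j, ?_⟩
  filter_upwards [hw, hb'] with n h2 h3
  have h7 := norm_sub_le ((Y n ω - θ) + w n) (w n)
  rw [add_sub_cancel_right] at h7
  linarith

end PreconditionedSGD

/-! ### Positive definite matrices as operators -/

section Matrices

variable {d : ℕ}

theorem inner_toEuclideanCLM (A : Matrix (Fin d) (Fin d) ℝ) (u : EuclideanSpace ℝ (Fin d)) :
    inner ℝ u (Matrix.toEuclideanCLM (n := Fin d) (𝕜 := ℝ) A u) =
      star u.ofLp ⬝ᵥ (A.mulVec u.ofLp) := by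
  simp [PiLp.inner_apply, dotProduct, mul_comm]

theorem exists_coercive_of_posDef {A : Matrix (Fin d) (Fin d) ℝ} (hA : A.PosDef) :
    ∃ κ : ℝ, 0 < κ ∧ ∀ u : EuclideanSpace ℝ (Fin d),
      κ * ‖u‖ ^ 2 ≤ inner ℝ u (Matrix.toEuclideanCLM (n := Fin d) (𝕜 := ℝ) A u) := by
  set T := Matrix.toEuclideanCLM (n := Fin d) (𝕜 := ℝ) A with hT
  have hpos : ∀ u : EuclideanSpace ℝ (Fin d), u ≠ 0 → 0 < inner ℝ u (T u) := by
    intro u hu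
    rw [hT, inner_toEuclideanCLM]
    exact hA.dotProduct_mulVec_pos fun h => hu (by ext i; exact congrFun h i)
  rcases (Metric.sphere (0 : EuclideanSpace ℝ (Fin d)) 1).eq_empty_or_nonempty with he | hne
  · refine ⟨1, one_pos, fun u => ?_⟩
    rcases eq_or_ne u 0 with rfl | hu
    · simp
    · have : ‖u‖⁻¹ • u ∈ Metric.sphere (0 : EuclideanSpace ℝ (Fin d)) 1 := by
        simp [norm_smul, hu]
      simp [he] at this
  · obtain ⟨w, hw, hmin⟩ := (isCompact_sphere (0 : EuclideanSpace ℝ (Fin d)) 1).exists_isMinOn hne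
      (f := fun u => inner ℝ u (T u)) (by fun_prop)
    have hw0 : w ≠ 0 := by
      rintro rfl
      simp at hw
    refine ⟨inner ℝ w (T w), hpos w hw0, fun u => ?_⟩
    rcases eq_or_ne u 0 with rfl | hu
    · simp
    · have hu' : ‖u‖ ≠ 0 := norm_ne_zero_iff.2 hu
      have h1 : inner ℝ w (T w) ≤ inner ℝ (‖u‖⁻¹ • u) (T (‖u‖⁻¹ • u)) :=
        hmin (show ‖u‖⁻¹ • u ∈ Metric.sphere (0 : EuclideanSpace ℝ (Fin d)) 1 by
          simp [norm_smul, hu])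
      rw [map_smul, inner_smul_left, inner_smul_right] at h1
      simp only [conj_trivial] at h1
      calc inner ℝ w (T w) * ‖u‖ ^ 2
          ≤ ‖u‖⁻¹ * (‖u‖⁻¹ * inner ℝ u (T u)) * ‖u‖ ^ 2 := by gcongr
        _ = inner ℝ u (T u) := by field_simp

theorem inv_eq_inv_det_smul (A : Matrix (Fin d) (Fin d) ℝ) : A⁻¹ = A.det⁻¹ • A.adjugate := by
  rw [Matrix.inv_def, Ring.inverse_eq_inv']

theorem continuous_toEuclideanCLM :
    Continuous (fun A : Matrix (Fin d) (Fin d) ℝ =>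
      Matrix.toEuclideanCLM (n := Fin d) (𝕜 := ℝ) A) :=
  LinearMap.continuous_of_finiteDimensional
    ((Matrix.toEuclideanCLM (n := Fin d) (𝕜 := ℝ)).toAlgEquiv.toLinearMap)

theorem tendsto_toEuclideanCLM_inv {S : ℕ → Matrix (Fin d) (Fin d) ℝ}
    {A : Matrix (Fin d) (Fin d) ℝ} (hA : A.PosDef) (hS : Tendsto S atTop (𝓝 A)) :
    Tendsto (fun n => Matrix.toEuclideanCLM (n := Fin d) (𝕜 := ℝ) (S n)⁻¹) atTop
      (𝓝 (Matrix.toEuclideanCLM (n := Fin d) (𝕜 := ℝ) A⁻¹)) := by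
  refine (continuous_toEuclideanCLM.tendsto _).comp ?_
  simp only [inv_eq_inv_det_smul]
  have h1 : Tendsto (fun n => (S n).det) atTop (𝓝 A.det) :=
    ((continuous_id.matrix_det).tendsto A).comp hS
  have h2 : Tendsto (fun n => (S n).adjugate) atTop (𝓝 A.adjugate) :=
    ((continuous_id.matrix_adjugate).tendsto A).comp hS
  exact (h1.inv₀ hA.det_pos.ne').smul h2

theorem measurable_toEuclideanCLM_inv {Ω : Type*} {m : MeasurableSpace Ω}
    {S : Ω → Matrix (Fin d) (Fin d) ℝ} (hS : ∀ i j, Measurable fun ω => S ω i j) :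
    Measurable fun ω => Matrix.toEuclideanCLM (n := Fin d) (𝕜 := ℝ) (S ω)⁻¹ := by
  let Φ : (Fin d → Fin d → ℝ) → EuclideanSpace ℝ (Fin d) →L[ℝ] EuclideanSpace ℝ (Fin d) :=
    fun A => (Matrix.det (Matrix.of A))⁻¹ •
      Matrix.toEuclideanCLM (n := Fin d) (𝕜 := ℝ) (Matrix.adjugate (Matrix.of A))
  have hof : Continuous fun A : Fin d → Fin d → ℝ => Matrix.of A := continuous_id
  have h1 : Measurable fun A : Fin d → Fin d → ℝ => Matrix.det (Matrix.of A) :=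
    (hof.matrix_det).measurable
  have h2 : Measurable fun A : Fin d → Fin d → ℝ =>
      Matrix.toEuclideanCLM (n := Fin d) (𝕜 := ℝ) (Matrix.adjugate (Matrix.of A)) :=
    (continuous_toEuclideanCLM.comp hof.matrix_adjugate).measurable
  have hΦ : Measurable Φ := h1.inv.smul h2
  have hS' : Measurable fun ω => (fun i j => S ω i j : Fin d → Fin d → ℝ) :=
    measurable_pi_iff.2 fun i => measurable_pi_iff.2 fun j => hS i j
  have e : (fun ω => Matrix.toEuclideanCLM (n := Fin d) (𝕜 := ℝ) (S ω)⁻¹) =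
      fun ω => Φ (fun i j => S ω i j) := by
    funext ω
    rw [inv_eq_inv_det_smul, map_smul]
    rfl
  rw [e]
  exact hΦ.comp hS'

theorem exists_forall_of_eventually {p : ℕ → ℝ → Prop}
    (hmono : ∀ n K K', K ≤ K' → p n K → p n K') (heach : ∀ n, ∃ K, p n K)
    (hev : ∃ K, ∀ᶠ n in atTop, p n K) : ∃ K, ∀ n, p n K := by
  obtain ⟨K, hK⟩ := hev
  obtain ⟨N, hN⟩ := eventually_atTop.1 hK
  choose k hk using heach
  obtain ⟨b, hb⟩ := ((Set.finite_lt_nat N).image k).bddAbove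
  refine ⟨max K b, fun n => ?_⟩
  rcases lt_or_ge n N with h | h
  · exact hmono n _ _ ((hb ⟨n, h, rfl⟩).trans (le_max_right _ _)) (hk n)
  · exact hmono n _ _ (le_max_left _ _) (hN n h)

/-- A convergent sequence of coercive operators with a coercive limit is bounded and uniformly
coercive. -/
theorem exists_uniform_bound {T : ℕ → EuclideanSpace ℝ (Fin d) →L[ℝ] EuclideanSpace ℝ (Fin d)}
    {A : EuclideanSpace ℝ (Fin d) →L[ℝ] EuclideanSpace ℝ (Fin d)}
    (hlim : Tendsto T atTop (𝓝 A))
    (hT : ∀ n, ∃ κ : ℝ, 0 < κ ∧ ∀ u, κ * ‖u‖ ^ 2 ≤ inner ℝ u (T n u))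
    (hA : ∃ κ : ℝ, 0 < κ ∧ ∀ u, κ * ‖u‖ ^ 2 ≤ inner ℝ u (A u)) :
    ∃ K : ℝ, ∀ n, ‖T n‖ ≤ K ∧ ∀ u, ‖u‖ ^ 2 ≤ K * inner ℝ u (T n u) := by
  have hof : ∀ (T' : EuclideanSpace ℝ (Fin d) →L[ℝ] EuclideanSpace ℝ (Fin d)) (κ b : ℝ), 0 < κ →
      ‖T'‖ ≤ b → (∀ u, κ * ‖u‖ ^ 2 ≤ inner ℝ u (T' u)) →
      0 < max b κ⁻¹ ∧ ‖T'‖ ≤ max b κ⁻¹ ∧ ∀ u, ‖u‖ ^ 2 ≤ max b κ⁻¹ * inner ℝ u (T' u) := by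
    intro T' κ b hκ hb h
    refine ⟨lt_max_of_lt_right (inv_pos.2 hκ), hb.trans (le_max_left _ _), fun u => ?_⟩
    have h0 : 0 ≤ inner ℝ u (T' u) := le_trans (by positivity) (h u)
    calc ‖u‖ ^ 2 = κ⁻¹ * (κ * ‖u‖ ^ 2) := by field_simp
      _ ≤ κ⁻¹ * inner ℝ u (T' u) := mul_le_mul_of_nonneg_left (h u) (inv_pos.2 hκ).le
      _ ≤ _ := mul_le_mul_of_nonneg_right (le_max_right _ _) h0
  suffices h : ∃ K, ∀ n, 0 < K ∧ ‖T n‖ ≤ K ∧ ∀ u, ‖u‖ ^ 2 ≤ K * inner ℝ u (T n u) by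
    obtain ⟨K, hK⟩ := h
    exact ⟨K, fun n => (hK n).2⟩
  refine exists_forall_of_eventually
    (p := fun n K => 0 < K ∧ ‖T n‖ ≤ K ∧ ∀ u, ‖u‖ ^ 2 ≤ K * inner ℝ u (T n u)) ?_ ?_ ?_
  · rintro n K K' hKK' ⟨h1, h2, h3⟩
    refine ⟨h1.trans_le hKK', h2.trans hKK', fun u => ?_⟩
    have h0 : 0 ≤ inner ℝ u (T n u) := by
      by_contra! h
      exact absurd (h3 u) (not_le.2 ((mul_neg_of_pos_of_neg h1 h).trans_le (sq_nonneg _)))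
    exact (h3 u).trans (mul_le_mul_of_nonneg_right hKK' h0)
  · intro n
    obtain ⟨κ, hκ, h⟩ := hT n
    exact ⟨_, hof (T n) κ _ hκ le_rfl h⟩
  · obtain ⟨κ, hκ, h⟩ := hA
    have h1 : ∀ᶠ n in atTop, ‖T n‖ ≤ ‖A‖ + 1 := hlim.norm.eventually_le_const (by linarith)
    have h2 : ∀ᶠ n in atTop, ‖T n - A‖ ≤ κ / 2 :=
      (tendsto_iff_norm_sub_tendsto_zero.1 hlim).eventually_le_const (half_pos hκ)
    refine ⟨max (‖A‖ + 1) (κ / 2)⁻¹, ?_⟩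
    filter_upwards [h1, h2] with n h1 h2
    refine hof (T n) (κ / 2) _ (half_pos hκ) h1 fun u => ?_
    have h3 := (abs_le.1 (abs_real_inner_le_norm u ((T n - A) u))).1
    have h4 : ‖u‖ * ‖(T n - A) u‖ ≤ κ / 2 * ‖u‖ ^ 2 := by
      calc ‖u‖ * ‖(T n - A) u‖ ≤ ‖u‖ * (κ / 2 * ‖u‖) := by
            gcongr
            exact ((T n - A).le_opNorm u).trans (by gcongr)
        _ = _ := by ring
    rw [sub_apply] at h4
    rw [sub_apply, inner_sub_right] at h3
    linarith [h u]

theorem contDiff_gradient {G : EuclideanSpace ℝ (Fin d) → ℝ} (hG : ContDiff ℝ 2 G) :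
    ContDiff ℝ 1 (gradient G) := by
  have h : ContDiff ℝ 1 (fderiv ℝ G) := hG.fderiv_right (by norm_num)
  exact ((InnerProductSpace.toDual ℝ (EuclideanSpace ℝ (Fin d))).symm.contDiff).comp h

theorem toEuclideanCLM_hessian (G : EuclideanSpace ℝ (Fin d) → ℝ)
    (h : EuclideanSpace ℝ (Fin d)) :
    Matrix.toEuclideanCLM (n := Fin d) (𝕜 := ℝ) (hessian G h) = fderiv ℝ (gradient G) h := by
  have e : ∀ j : Fin d, Matrix.toEuclideanCLM (n := Fin d) (𝕜 := ℝ) (hessian G h)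
      (EuclideanSpace.single j 1) = fderiv ℝ (gradient G) h (EuclideanSpace.single j 1) := by
    intro j
    ext i
    simp [hessian, Matrix.mulVec_single]
  refine ContinuousLinearMap.coe_injective
    ((EuclideanSpace.basisFun (Fin d) ℝ).toBasis.ext fun j => ?_)
  simpa using e j

end Matrices

end WASNA

/-! ### The stochastic Newton iterates -/

theorem mainTheorem3 {d : ℕ} {Ω 𝒳 : Type*} [mΩ : MeasurableSpace Ω] [MeasurableSpace 𝒳]
    (μ : Measure Ω) [IsProbabilityMeasure μ]
    -- `P` is the law of `X`
    (P : Measure 𝒳) [IsProbabilityMeasure P]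
    (g : 𝒳 → EuclideanSpace ℝ (Fin d) → ℝ)
    (hg_meas : Measurable (Function.uncurry g))
    (hg_int : ∀ h, Integrable (fun x => g x h) P)
    (hG_convex : ConvexOn ℝ Set.univ (WASNA.risk P g))
    -- `X 1, X 2, …` are i.i.d. copies of `X` (the term `X 0` is never used)
    (X : ℕ → Ω → 𝒳)
    (hX_meas : ∀ n, Measurable (X (n + 1)))
    (hX_law : ∀ n, μ.map (X (n + 1)) = P)
    (hX_indep : iIndepFun (fun n => X (n + 1)) μ)
    -- parameters of the algorithm
    (c c' γ : ℝ) (hc : 0 < c) (hc' : 0 ≤ c') (hγ : 1 / 2 < γ) (hγ' : γ < 1)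
    (S : ℕ → Ω → Matrix (Fin d) (Fin d) ℝ)
    (hS_pos : ∀ᵐ ω ∂μ, ∀ n, (S n ω).PosDef)
    (θ₀ : Ω → EuclideanSpace ℝ (Fin d))
    (ℱ : Filtration ℕ mΩ)
    (hS_meas : ∀ n i j, Measurable[ℱ n] (fun ω => S n ω i j))
    (hθ_meas : ∀ n, Measurable[ℱ n] (WASNA.thetaTilde g X S (WASNA.stepSize c c' γ) θ₀ n))
    (hX_indep_ℱ : ∀ n, Indep (MeasurableSpace.comap (X (n + 1)) inferInstance) (ℱ n) μ)
    -- (A1)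
    (hg_diff : ∀ᵐ x ∂P, Differentiable ℝ (g x))
    (θ : EuclideanSpace ℝ (Fin d))
    (hA1a : gradient (WASNA.risk P g) θ = 0)
    (hA1b : ∃ C C' : ℝ, 0 ≤ C ∧ 0 ≤ C' ∧ ∀ h,
      Integrable (fun x => ‖gradient (g x) h‖ ^ 2) P ∧
      ∫ x, ‖gradient (g x) h‖ ^ 2 ∂P ≤ C + C' * (WASNA.risk P g h - WASNA.risk P g θ))
    (hA1c : ContinuousAt (WASNA.gradSecondMoment P g) θ)
    -- (A2), (A2a), (A2b)
    (hA2 : ContDiff ℝ 2 (WASNA.risk P g))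
    (hA2a : ∃ L : ℝ, 0 < L ∧ ∀ h, WASNA.opNorm (WASNA.hessian (WASNA.risk P g) h) ≤ L)
    (hA2b : (WASNA.hessian (WASNA.risk P g) θ).PosDef)
    -- (H1')
    (hH1 : ∃ β : ℝ, 0 < β ∧ β < γ - 1 / 2 ∧
      (∀ᵐ ω ∂μ, (fun n => WASNA.lambdaMax (S n ω)) =O[atTop] (fun _ => (1 : ℝ))) ∧
      (∀ᵐ ω ∂μ, (fun n => WASNA.lambdaMax (S n ω)⁻¹) =O[atTop] (fun n : ℕ => (n : ℝ) ^ β)))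
    -- (H2a')
    (hH2a : ∀ᵐ ω ∂μ, Tendsto (fun n => S n ω) atTop (𝓝 (WASNA.hessian (WASNA.risk P g) θ)))
    -- moment of order `2 + 2η`
    (hmoment : ∃ η Cη : ℝ, 0 < η ∧ 1 / γ - 1 < η ∧ 0 < Cη ∧ ∀ h,
      Integrable (fun x => ‖gradient (g x) h‖ ^ (2 + 2 * η)) P ∧
      ∫ x, ‖gradient (g x) h‖ ^ (2 + 2 * η) ∂P ≤ Cη * (1 + ‖h - θ‖ ^ (2 + 2 * η))) :
    ∀ᵐ ω ∂μ,
      (fun n => ‖WASNA.thetaTilde g X S (WASNA.stepSize c c' γ) θ₀ n ω - θ‖ ^ 2)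
        =O[atTop] (fun n : ℕ => Real.log n / (n : ℝ) ^ γ) := by
  obtain ⟨C, C', hC, hC', hsq⟩ := hA1b
  obtain ⟨L, hL, hLop⟩ := hA2a
  obtain ⟨η, Cη, -, hη', hCη, hmom⟩ := hmoment
  set G := WASNA.risk P g with hGdef
  set Y := WASNA.thetaTilde g X S (WASNA.stepSize c c' γ) θ₀ with hYdef
  set B : ℕ → Ω → EuclideanSpace ℝ (Fin d) →L[ℝ] EuclideanSpace ℝ (Fin d) :=
    fun n ω => Matrix.toEuclideanCLM (n := Fin d) (𝕜 := ℝ) (S n ω)⁻¹ with hB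
  have hγ0 : 0 < γ := by linarith
  have hslow := WASNA.slowStep_stepSize hc hc' hγ0 hγ'
  have hGd : Differentiable ℝ G := hA2.differentiable (by norm_num)
  have hgradd : Differentiable ℝ (gradient G) :=
    (WASNA.contDiff_gradient hA2).differentiable (by norm_num)
  obtain ⟨D, hDm, hDae⟩ := WASNA.exists_measurable_gradient hg_meas hg_diff
  have hDsq : ∀ h, Integrable (fun x => ‖D x h‖ ^ 2) P := fun h =>
    (hsq h).1.congr (by filter_upwards [hDae] with x hx; rw [hx h])
  have hDle : ∀ h, ∫ x, ‖D x h‖ ^ 2 ∂P ≤ C + C' * (G h - G θ) := fun h => by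
    refine le_of_eq_of_le (integral_congr_ae ?_) (hsq h).2
    filter_upwards [hDae] with x hx
    rw [hx h]
  have hDq : ∀ h, Integrable (fun x => ‖D x h‖ ^ (2 + 2 * η)) P := fun h =>
    (hmom h).1.congr (by filter_upwards [hDae] with x hx; rw [hx h])
  have hDqle : ∀ h, ∫ x, ‖D x h‖ ^ (2 + 2 * η) ∂P ≤ Cη * (1 + ‖h - θ‖ ^ (2 + 2 * η)) :=
    fun h => by
      refine le_of_eq_of_le (integral_congr_ae ?_) (hmom h).2
      filter_upwards [hDae] with x hx
      rw [hx h]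
  have hinner := WASNA.integral_inner_gradient_eq hDm (hg_diff.and hDae) hg_int hDsq
    (ψ := fun h => C + C' * (G h - G θ))
    (continuous_const.add (continuous_const.mul (hGd.continuous.sub continuous_const))) hDle hGd
  have hlip : ∀ z w, ‖gradient G z - gradient G w‖ ≤ L * ‖z - w‖ := fun z w =>
    convex_univ.norm_image_sub_le_of_norm_fderiv_le (𝕜 := ℝ) (fun x _ => hgradd x)
      (fun x _ => by rw [← WASNA.toEuclideanCLM_hessian]; exact hLop x)
      (Set.mem_univ w) (Set.mem_univ z)
  have hsample : ∀ᵐ ω ∂μ, ∀ n h, D (X (n + 1) ω) h = gradient (g (X (n + 1) ω)) h := by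
    rw [ae_all_iff]
    intro n
    rw [← hX_law n] at hDae
    exact ae_of_ae_map (hX_meas n).aemeasurable hDae
  have M : WASNA.PreconditionedSGD μ P D G θ X ℱ (WASNA.stepSize c c' γ) Y B L C C' :=
    { measurable_D := hDm
      integrable_inner := fun h v => (hinner h v).1
      integral_inner := fun h v => (hinner h v).2
      integrable_sq := hDsq
      integral_sq_le := hDle
      C_nonneg := hC
      C'_nonneg := hC'
      convexOn := hG_convex
      differentiable := hGd
      gradient_eq_zero := hA1a
      L_nonneg := hL.le
      lipschitz := hlip
      measurable_X := hX_meas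
      law_X := hX_law
      indep := hX_indep_ℱ
      measurable_Y := hθ_meas
      measurable_B := fun n => WASNA.measurable_toEuclideanCLM_inv (hS_meas n)
      slowStep := hslow
      step := by
        filter_upwards [hsample] with ω hω n
        rw [hω]
        rfl }
  set A := fderiv ℝ (gradient G) θ with hAdef
  have hA : HasFDerivAt (gradient G) A θ := (hgradd θ).hasFDerivAt
  have hAH : Matrix.toEuclideanCLM (n := Fin d) (𝕜 := ℝ) (WASNA.hessian G θ) = A :=
    WASNA.toEuclideanCLM_hessian G θ
  obtain ⟨κ, hκ, hcoer⟩ := WASNA.exists_coercive_of_posDef hA2b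
  rw [hAH] at hcoer
  obtain ⟨m, r, hm, hr, hgrow⟩ :=
    WASNA.exists_linear_growth_of_hessian hG_convex hGd hA1a hA hκ hcoer
  set A' := Matrix.toEuclideanCLM (n := Fin d) (𝕜 := ℝ) (WASNA.hessian G θ)⁻¹ with hA'
  have hBlim : ∀ᵐ ω ∂μ, Tendsto (fun n => B n ω) atTop (𝓝 A') := by
    filter_upwards [hH2a] with ω hω
    exact WASNA.tendsto_toEuclideanCLM_inv hA2b hω
  have hBbd : ∀ᵐ ω ∂μ, ∃ K : ℝ, ∀ n, ‖B n ω‖ ≤ K ∧ ∀ u, ‖u‖ ^ 2 ≤ K * inner ℝ u (B n ω u) := by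
    filter_upwards [hBlim, hS_pos] with ω h1 h2
    exact WASNA.exists_uniform_bound h1 (fun n => WASNA.exists_coercive_of_posDef (h2 n).inv)
      (WASNA.exists_coercive_of_posDef hA2b.inv)
  have hinv : ∀ u, A' (A u) = u := fun u => by
    rw [← hAH, hA', ← mul_apply_eq_comp, ← map_mul,
      Matrix.nonsing_inv_mul _ hA2b.det_pos.ne'.isUnit, map_one, one_apply_eq_self]
  have hY := M.ae_tendsto (WASNA.summable_stepSize_sq hc hc' hγ) hm hr hgrow hBbd
  have hq : 2 / γ < 2 + 2 * η := by
    have : 2 / γ = 2 * (1 / γ) := by ring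
    linarith
  have hη : 0 < η := by
    have : 1 < 1 / γ := by rw [lt_div_iff₀ hγ0]; linarith
    linarith
  have hrate := M.ae_norm_sub_le_rate (q := 2 + 2 * η) (by linarith)
    (WASNA.summable_rate_rpow hc hc' hγ0 hq) hDq hDqle hCη.le hA hinv hY hBlim
  filter_upwards [hrate] with ω ⟨b, hb⟩
  refine IsBigO.of_bound (b ^ 2 * c) ?_
  filter_upwards [hb, eventually_ge_atTop 1] with n hn hn1
  have hlog := Real.log_natCast_nonneg n
  have hstep := WASNA.stepSize_nonneg (γ := γ) hc hc' n
  rw [Real.norm_eq_abs, Real.norm_eq_abs, abs_of_nonneg (sq_nonneg _),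
    abs_of_nonneg (by positivity)]
  calc ‖Y n ω - θ‖ ^ 2 ≤ (b * WASNA.rate (WASNA.stepSize c c' γ) n) ^ 2 :=
        pow_le_pow_left₀ (norm_nonneg _) hn 2
    _ = b ^ 2 * (WASNA.stepSize c c' γ n * Real.log n) := by
        rw [mul_pow, WASNA.rate, Real.sq_sqrt (mul_nonneg hstep hlog)]
    _ ≤ b ^ 2 * (c / (n : ℝ) ^ γ * Real.log n) := by
        gcongr
        exact WASNA.stepSize_le hc hc' hγ0 hn1
    _ = b ^ 2 * c * (Real.log n / (n : ℝ) ^ γ) := by ring
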